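/- Conventions. Let $G$ be a group with a finite generating set $X$, and let $d$ be the path metric on the vertices of the Cayley graph $\Gamma(G,X)$. Words are words in the letters of $X$ and their inverses. The path with initial vertex $g$ and label $w$ is at the vertex $w(t)$ after $t$ edges ($t$ an integer, $t\ge 0$), and $w(t)$ is its endpoint for $t>|w|$. A loop is a path that ends where it starts. * $(G,X)$ has the loop shortening property if there is a constant $k>0$ such that for each loop $w$ of positive length there is a loop $u$, possibly with a different base vertex, with $|u|<|w|$ and $d(w(t),u(t))\le k$ for all integers $t\ge 0$. * $(G,X)$ is almost convex if there is a constant $C$ such that for every $N$, any two vertices at distance at most $2$ from each other and at most $N$ from the identity are joined by a path of length at most $C$ all of whose vertices are within distance $N$ of the identity. * For a finite presentation $\langle X\mid R\rangle$ of $G$, the area $A(w)$ of a word $w$ representing the identity is the least $k$ such that $w$ is freely equal to $\prod_{i=1}^k g_ir_ig_i^{-1}$ with $g_i\in F(X)$, $r_i\in R\cup R^{-1}$; the Dehn function is $\delta(n)=\max\{A(w): w=_G1,\ |w|\le n\}$. It is quadratic if there are constants with $\delta(n)\le A(Bn+C)^2+Dn+E$ and $n^2\le A'\,\delta(B'n+C')+D'n+E'$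 for all $n$. Theorem 6.9. Let $(G_G,X)$ be Gersten's group with its presentation $$\langle a,b,c,d,s,t\mid c=ab,\ c=ba,\ d=ab^{-1},\ s^{-1}as=c,\ t^{-1}at=d\rangle .$$ Then $(G_G,X)$ does not have the loop shortening property. On the other hand, $(G_G,X)$ is almost convex and the Dehn function of this presentation is quadratic. Hence almost convexity together with a quadratic Dehn function does not imply the loop shortening property: it is not true that, for every finite presentation $\langle X\mid R\rangle$ of a group $G$ with quadratic Dehn function and $(G,X)$ almost convex, the pair $(G,X)$ has the loop shortening property. -/

import Mathlib

/-! ### Words, paths and the word metric of a marked group `(G, X)`, where `X` is the family `x` -/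

/-- The element of `G` spelled by a word in the letters `x i` and their inverses; the letter
`(i, true)` is `x i` and the letter `(i, false)` is `(x i)⁻¹`. -/
def wordVal {G ι : Type*} [Group G] (x : ι → G) (w : List (ι × Bool)) : G :=
  (w.map fun p => if p.2 then x p.1 else (x p.1)⁻¹).prod

/-- The vertex `w(t)` of the Cayley graph reached after `t` edges of the path with initial vertex
`g` and label `w`; for `t > |w|` it is the endpoint of the path. -/
def pathPoint {G ι : Type*} [Group G] (x : ι → G) (g : G) (w : List (ι × Bool)) (t : ℕ) : G :=
  g * wordVal x (w.take t)

/-- The path metric of the Cayley graph on its vertices (`⊤` if no path joins `g` to `h`). -/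
noncomputable def wordDist {G ι : Type*} [Group G] (x : ι → G) (g h : G) : ℕ∞ :=
  ⨅ (w : List (ι × Bool)) (_ : g * wordVal x w = h), (w.length : ℕ∞)

theorem wordDist_le_iff {G ι : Type*} [Group G] (x : ι → G) (g h : G) (n : ℕ) :
    wordDist x g h ≤ n ↔ ∃ w : List (ι × Bool), g * wordVal x w = h ∧ w.length ≤ n := by
  constructor
  · intro hn
    have h1 : wordDist x g h < ((n + 1 : ℕ) : ℕ∞) :=
      lt_of_le_of_lt hn (by exact_mod_cast Nat.lt_succ_self n)
    simp only [wordDist, iInf_lt_iff] at h1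
    obtain ⟨w, hw, hl⟩ := h1
    exact ⟨w, hw, Nat.lt_succ_iff.mp (by exact_mod_cast hl)⟩
  · rintro ⟨w, hw, hl⟩
    exact (iInf₂_le w hw).trans (by exact_mod_cast hl)

/-- The paths `(g, w)` and `(h, u)` (initial vertex and label) synchronously `k`-fellow travel. -/
def FellowTravel {G ι : Type*} [Group G] (x : ι → G) (k : ℕ)
    (g : G) (w : List (ι × Bool)) (h : G) (u : List (ι × Bool)) : Prop :=
  ∀ t : ℕ, wordDist x (pathPoint x g w t) (pathPoint x h u t) ≤ k

/-- The loop shortening property: every nonempty loop is fellow travelled by a shorter loop,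
possibly with a different base vertex. (The empty loop has to be left out: no loop is shorter.) -/
def LoopShortening {G ι : Type*} [Group G] (x : ι → G) : Prop :=
  ∃ k : ℕ, 0 < k ∧ ∀ (g : G) (w : List (ι × Bool)), w ≠ [] → g * wordVal x w = g →
    ∃ (h : G) (u : List (ι × Bool)), h * wordVal x u = h ∧ u.length < w.length ∧
      FellowTravel x k g w h u

/-- Almost convexity: any two vertices of a ball `B(N)` about the identity that are at distance at
most `2` are joined by a path of length at most `C` that stays in `B(N)`. -/
def AlmostConvex {G ι : Type*} [Group G] (x : ι → G) : Prop :=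
  ∃ C : ℕ, ∀ (N : ℕ) (g h : G), wordDist x 1 g ≤ N → wordDist x 1 h ≤ N → wordDist x g h ≤ 2 →
    ∃ w : List (ι × Bool), g * wordVal x w = h ∧ w.length ≤ C ∧
      ∀ t : ℕ, wordDist x 1 (pathPoint x g w t) ≤ N

/-! ### Area and Dehn function of a presentation -/

/-- `IsRelatorProduct rels k v`: in the free group, `v` is a product of `k` conjugates of elements
of `rels` and their inverses. -/
def IsRelatorProduct {α : Type*} (rels : Set (FreeGroup α)) (k : ℕ) (v : FreeGroup α) : Prop :=
  ∃ l : List (FreeGroup α), l.length = k ∧ l.prod = v ∧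
    ∀ y ∈ l, ∃ g r : FreeGroup α, (r ∈ rels ∨ r⁻¹ ∈ rels) ∧ y = g * r * g⁻¹

/-- The area of an element of the normal closure of the relators. -/
noncomputable def relArea {α : Type*} (rels : Set (FreeGroup α)) (v : FreeGroup α) : ℕ :=
  sInf {k : ℕ | IsRelatorProduct rels k v}

/-- The areas of the words of length at most `n` that represent the identity. -/
def areaSet {α : Type*} (rels : Set (FreeGroup α)) (n : ℕ) : Set ℕ :=
  {k | ∃ w : List (α × Bool), w.length ≤ n ∧ PresentedGroup.mk rels (FreeGroup.mk w) = 1 ∧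
    k = relArea rels (FreeGroup.mk w)}

/-- The Dehn function of a presentation with finitely many generators. -/
noncomputable def dehnFunction {α : Type*} (rels : Set (FreeGroup α)) (n : ℕ) : ℕ :=
  sSup (areaSet rels n)

/-- The supremum in the definition of the Dehn function is a maximum over a finite set. -/
theorem areaSet_finite {α : Type*} [Finite α] (rels : Set (FreeGroup α)) (n : ℕ) :
    (areaSet rels n).Finite := by
  refine ((List.finite_length_le (α × Bool) n).image
    fun w => relArea rels (FreeGroup.mk w)).subset ?_
  rintro k ⟨w, hw, -, rfl⟩
  exact ⟨w, hw, rfl⟩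

/-- `f` is bounded by `g` up to the constants allowed in the equivalence of Dehn functions. -/
def DehnLE (f g : ℕ → ℕ) : Prop :=
  ∃ A B C D E : ℕ, ∀ n, f n ≤ A * g (B * n + C) + D * n + E

/-- The Dehn function of the presentation is quadratic, that is, equivalent to `n ↦ n ^ 2`. -/
def QuadraticDehn {α : Type*} (rels : Set (FreeGroup α)) : Prop :=
  DehnLE (dehnFunction rels) (fun n => n ^ 2) ∧ DehnLE (fun n => n ^ 2) (dehnFunction rels)

/-! ### Gersten's group -/

/-- The generating letters. -/
inductive GerstenGen : Type
  | a | b | c | d | s | t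

/-- The letters as elements of the free group. -/
def gfree (y : GerstenGen) : FreeGroup GerstenGen := FreeGroup.of y

open GerstenGen in
/-- The relators of `c = ab`, `c = ba`, `d = ab⁻¹`, `s⁻¹as = c`, `t⁻¹at = d`. -/
def gerstenRels : Set (FreeGroup GerstenGen) :=
  {(gfree c)⁻¹ * (gfree a * gfree b),
   (gfree c)⁻¹ * (gfree b * gfree a),
   (gfree d)⁻¹ * (gfree a * (gfree b)⁻¹),
   (gfree c)⁻¹ * ((gfree s)⁻¹ * gfree a * gfree s),
   (gfree d)⁻¹ * ((gfree t)⁻¹ * gfree a * gfree t)}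

/-- The family of generators of the group of a presentation given by its letters. -/
def presentedGens {α : Type*} (rels : Set (FreeGroup α)) : α → PresentedGroup rels :=
  PresentedGroup.of

/-! ### A model of Gersten's group: planes glued along lines of slope `0`, `1` and `-1` -/

/-! The group is a multiple HNN extension of the free abelian group on `a` and `b`: the letter `s`
conjugates `a` to `ab`, and `t` conjugates `a` to `ab⁻¹`. Its Cayley graph is therefore a tree of
planes, in which a line of slope `0` of one plane is joined to a line of slope `1` or `-1` of
another. A point is given by its coordinates in its plane and a reduced stack of crossings; letting
the generators act on such points proves that this is a normal form (`siteElt_site`,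
`site_injective`). Since `c` and `d` are generators, the metric of a plane is the sup norm, and
every line of slope `0`, `1` or `-1` is parametrized isometrically by its abscissa. The gluing is
thus isometric, the planes are isometrically embedded (`plane_isometric`), and the distance to the
identity is computed plane by plane: in a new plane it is the infimal convolution of the sup norm
with the distance along the entry line (`wordDist_one_le_iff`, `infConv_height`).

Almost convexity. The distance to the identity, restricted to any line of slope `0`, `1` or `-1` in
any plane, has no strict ascent followed by a strict descent. This does not propagate by itself from
plane to plane, but the stronger condition `DyadicConvex` does (`balanced_height`): passing between
horizontal and diagonal lines doubles or halves the scale, so windows of all dyadic lengths are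
controlled together, and the error `1` never accumulates. Two nearby points of a ball are then
joined by moving along the entry line at the smaller of the two distances from it, and afterwards
straight away from it or towards it.

Loop shortening. Four lines of slopes `1` and `-1` bound a rhombus in the base plane, and a plane is
attached along each of them. A loop runs diagonally through these four planes, reaches height `m`
over the middle of each side and touches the base plane only at the corners. It is no longer than
the perimeter `8m` plus eight crossings. If `m > k`, a loop that `k`-fellow travels it visits the
same four branches of the tree in the same order, and this already forces that length
(`length_ge_of_visits`).

Dehn function. For the upper bound, normal forms in the plane are chosen so that the points of the
glued lines are powers of `a`, `c` or `d`, and so that multiplying elements of norms `M` and `M'`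
costs `O(M * M')` (`planeNF_mul`). Cutting a word at a pinch then gives a quadratic bound by
induction (`area_planeNF`). For the lower bound, an action by polynomial shears sends each relator
to a bounded vertical translation and the commutator of `a ^ n` and `b ^ n` to a translation by
`2n²` in absolute value. -/

/-- Gersten's group. -/
abbrev GerstenGroup : Type := PresentedGroup gerstenRels

/-- A homomorphism kills the relators if and only if the images of the letters satisfy the
relations. -/
theorem gersten_relations_iff {H : Type*} [Group H] (f : FreeGroup GerstenGen →* H) :
    (∀ r ∈ gerstenRels, f r = 1) ↔
      f (gfree .c) = f (gfree .a) * f (gfree .b) ∧ f (gfree .c) = f (gfree .b) * f (gfree .a) ∧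
      f (gfree .d) = f (gfree .a) * (f (gfree .b))⁻¹ ∧
      f (gfree .c) = (f (gfree .s))⁻¹ * f (gfree .a) * f (gfree .s) ∧
      f (gfree .d) = (f (gfree .t))⁻¹ * f (gfree .a) * f (gfree .t) := by
  simp only [gerstenRels, Set.mem_insert_iff, Set.mem_singleton_iff, forall_eq_or_imp,
    forall_eq, map_mul, map_inv, inv_mul_eq_one]

/-- The relations, in the group. -/
theorem gersten_relations :
    (presentedGens gerstenRels .c = presentedGens gerstenRels .a * presentedGens gerstenRels .b) ∧
    (presentedGens gerstenRels .c = presentedGens gerstenRels .b * presentedGens gerstenRels .a) ∧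
    (presentedGens gerstenRels .d =
      presentedGens gerstenRels .a * (presentedGens gerstenRels .b)⁻¹) ∧
    (presentedGens gerstenRels .c = (presentedGens gerstenRels .s)⁻¹ *
      presentedGens gerstenRels .a * presentedGens gerstenRels .s) ∧
    (presentedGens gerstenRels .d = (presentedGens gerstenRels .t)⁻¹ *
      presentedGens gerstenRels .a * presentedGens gerstenRels .t) :=
  (gersten_relations_iff (PresentedGroup.mk gerstenRels)).1
    fun _ hr => PresentedGroup.one_of_mem hr

/-- The sign `1` for the letter `s` and `-1` for the letter `t`. -/
def stableSign (σ : Bool) : ℤ := if σ then 1 else -1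

/-- The slope of the lines along which a plane is left through `s` or `t` (`up = true`), or through
`s⁻¹` or `t⁻¹` (`up = false`). -/
def exitSlope (σ up : Bool) : ℤ := if up then 0 else stableSign σ

theorem exitSlope_cases (σ up : Bool) :
    exitSlope σ up = 0 ∨ exitSlope σ up = 1 ∨ exitSlope σ up = -1 := by
  cases σ <;> cases up <;> simp [exitSlope, stableSign]

/-- The passage from a plane to an adjacent one through the line `y = exitSlope * x + offset`. -/
structure Crossing where
  /-- Which of the stable letters is used: `true` for `s`, `false` for `t`. -/
  sgn : Bool
  /-- Whether the letter or its inverse is used. -/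
  up : Bool
  /-- The ordinate at the origin of the line of the old plane. -/
  offset : ℤ

namespace Crossing

/-- The slope of the line in the plane that is left. -/
def out (e : Crossing) : ℤ := exitSlope e.sgn e.up

/-- The slope of the line in the plane that is entered. -/
def inn (e : Crossing) : ℤ := exitSlope e.sgn (!e.up)

/-- The crossing `e`, done after `e'`, is not the return through the line of `e'`. -/
def NoReturn (e e' : Crossing) : Prop := ¬ (e'.sgn = e.sgn ∧ e'.up = !e.up ∧ e.offset = 0)

end Crossing

/-- The effect of the stable letters on the data of a point: its coordinates in its plane and the
list of the crossings that lead to the plane, the last one first. -/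
def crossRaw (σ up : Bool) : ℤ × ℤ × List Crossing → ℤ × ℤ × List Crossing
  | (x, y, []) => (x, exitSlope σ (!up) * x, [⟨σ, up, y - exitSlope σ up * x⟩])
  | (x, y, e :: r) =>
    if e.sgn = σ ∧ e.up = !up ∧ y = exitSlope σ up * x then
      (x, exitSlope σ (!up) * x + e.offset, r)
    else (x, exitSlope σ (!up) * x, ⟨σ, up, y - exitSlope σ up * x⟩ :: e :: r)

/-- The points of the planes. -/
abbrev Site : Type := {p : ℤ × ℤ × List Crossing // p.2.2.IsChain Crossing.NoReturn}

/-- The right action of the stable letters on the points. -/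
def cross (σ up : Bool) (p : Site) : Site :=
  ⟨crossRaw σ up p.1, by
    obtain ⟨⟨x, y, _ | ⟨e, r⟩⟩, h⟩ := p
    · simp [crossRaw]
    · simp only [crossRaw]
      split_ifs with hc
      · exact List.IsChain.tail h
      · refine List.isChain_cons_cons.2 ⟨?_, h⟩
        rintro ⟨h1, h2, h3⟩
        exact hc ⟨h1, h2, by simpa [sub_eq_zero] using h3⟩⟩

/-- When the first crossing cancels the top of the stack, the step back has to push that entry again
instead of cancelling the next one. The no-return condition on the stack guarantees this. -/
theorem cross_cross_not (σ up : Bool) (p : Site) : cross σ (!up) (cross σ up p) = p := by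
  apply Subtype.ext
  obtain ⟨⟨x, y, _ | ⟨e, r⟩⟩, h⟩ := p
  · simp [cross, crossRaw]
  · simp only [cross, crossRaw]
    split_ifs with hc
    · obtain ⟨h1, h2, rfl⟩ := hc
      obtain ⟨σ', up', k⟩ := e
      simp only at h1 h2
      subst h1 h2
      rcases r with _ | ⟨e', r⟩
      · simp
      · simp only
        rw [if_neg]
        · simp
        · rintro ⟨h1, h2, h3⟩
          have := (List.isChain_cons_cons.1 h).1
          exact this ⟨h1, by simpa using h2, by simpa using h3⟩
    · simp

/-- The translations of the planes. -/
def shift (u v : ℤ) : Equiv.Perm Site where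
  toFun p := ⟨(p.1.1 + u, p.1.2.1 + v, p.1.2.2), p.2⟩
  invFun p := ⟨(p.1.1 - u, p.1.2.1 - v, p.1.2.2), p.2⟩
  left_inv p := by ext <;> simp
  right_inv p := by ext <;> simp

/-- The right action of the generators on the points. -/
def genAct : GerstenGen → Equiv.Perm Site
  | .a => shift 1 0
  | .b => shift 0 1
  | .c => shift 1 1
  | .d => shift 1 (-1)
  | .s => ⟨cross true true, cross true false, cross_cross_not true true,
      cross_cross_not true false⟩
  | .t => ⟨cross false true, cross false false, cross_cross_not false true,
      cross_cross_not false false⟩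

/-- Both `s` and `t` leave through horizontal lines, so a horizontal translation does not change the
line that is met. This is the relation for the stable letter, read in the action. -/
theorem cross_shift (σ : Bool) (p : Site) :
    cross σ true (shift 1 0 p) = shift 1 (stableSign σ) (cross σ true p) := by
  apply Subtype.ext
  obtain ⟨⟨x, y, _ | ⟨e, r⟩⟩, h⟩ := p
  · simp [cross, crossRaw, shift, exitSlope, mul_add]
  · by_cases hc : e.sgn = σ ∧ e.up = false ∧ y = 0
    · simp [cross, crossRaw, shift, exitSlope, mul_add, hc]; ring
    · simp [cross, crossRaw, shift, exitSlope, mul_add, hc]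

/-- The left action on the points. -/
def siteHom : GerstenGroup →* Equiv.Perm Site :=
  -- Permutations compose from right to left, so the right action becomes a homomorphism after
  -- inversion.
  PresentedGroup.toGroup (f := fun y => (genAct y)⁻¹) (by
    have shift_mul : ∀ u v u' v', shift u v * shift u' v' = shift (u + u') (v + v') := by
      intro u v u' v'; ext p <;> simp [shift] <;> ring
    have shift_inv : ∀ u v, (shift u v)⁻¹ = shift (-u) (-v) := by
      intro u v; rw [inv_eq_iff_mul_eq_one, shift_mul]; ext p <;> simp [shift]
    have key : ∀ σ : Bool, ∀ S : Equiv.Perm Site, ⇑S = cross σ true →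
        shift 1 (stableSign σ) * (S * (shift 1 0)⁻¹ * S⁻¹) = 1 := by
      intro σ S hS
      rw [mul_assoc, ← mul_assoc, mul_eq_one_iff_eq_inv, mul_inv_rev, inv_inv, inv_inv, eq_comm]
      ext1 p
      simp only [Equiv.Perm.coe_mul, Function.comp_apply, hS, cross_shift]
    simp only [gerstenRels, Set.mem_insert_iff, Set.mem_singleton_iff, forall_eq_or_imp,
      forall_eq, map_mul, map_inv, gfree, FreeGroup.lift_apply_of, genAct, inv_inv]
    refine ⟨?_, ?_, ?_, key true _ rfl, key false _ rfl⟩ <;>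
    · simp only [shift_inv, shift_mul]
      ext p <;> simp [shift])

theorem siteHom_gen (y : GerstenGen) :
    siteHom (presentedGens gerstenRels y) = (genAct y)⁻¹ := PresentedGroup.toGroup.of _

/-- The origin of the base plane. -/
def originSite : Site := ⟨(0, 0, []), by simp⟩

/-- The point that corresponds to an element of the group. -/
def site (g : GerstenGroup) : Site := (siteHom g)⁻¹ originSite

/-- The right action of the group on the points. -/
theorem site_mul (g h : GerstenGroup) : site (g * h) = (siteHom h)⁻¹ (site g) := by
  simp [site]

theorem site_one : site 1 = originSite := by simp [site]

/-- The stable letters of the group. -/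
def stableLetter (σ : Bool) : GerstenGroup := presentedGens gerstenRels (if σ then .s else .t)

/-- The element `a ^ x * b ^ y` of the base plane. -/
def planeElt (x y : ℤ) : GerstenGroup :=
  presentedGens gerstenRels .a ^ x * presentedGens gerstenRels .b ^ y

/-! ### Recovering the group element from its point -/

theorem commute_ab :
    Commute (presentedGens gerstenRels .a) (presentedGens gerstenRels .b) :=
  gersten_relations.1.symm.trans gersten_relations.2.1

theorem planeElt_mul (x y x' y' : ℤ) :
    planeElt x y * planeElt x' y' = planeElt (x + x') (y + y') := by
  have := (commute_ab.zpow_zpow x' y).eq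
  simp only [planeElt, zpow_add]
  rw [mul_assoc, ← mul_assoc (_ ^ y), ← this]
  simp only [mul_assoc]

theorem planeElt_zero : planeElt 0 0 = 1 := by simp [planeElt]

theorem planeElt_inv (x y : ℤ) : (planeElt x y)⁻¹ = planeElt (-x) (-y) := by
  rw [inv_eq_iff_mul_eq_one, planeElt_mul]; simp [planeElt_zero]

theorem planeElt_zpow (x y n : ℤ) : planeElt x y ^ n = planeElt (n * x) (n * y) := by
  induction n with
  | zero => simp [planeElt_zero]
  | succ n ih => rw [zpow_add_one, ih, planeElt_mul]; ring_nf
  | pred n ih => rw [zpow_sub_one, ih, planeElt_inv, planeElt_mul]; ring_nf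

theorem gen_eq_planeElt :
    presentedGens gerstenRels .a = planeElt 1 0 ∧ presentedGens gerstenRels .b = planeElt 0 1 ∧
    presentedGens gerstenRels .c = planeElt 1 1 ∧
    presentedGens gerstenRels .d = planeElt 1 (-1) := by
  refine ⟨by simp [planeElt], by simp [planeElt], ?_, ?_⟩
  · simpa [planeElt] using gersten_relations.1
  · simpa [planeElt] using gersten_relations.2.2.1

theorem planeElt_mul_stableLetter (σ : Bool) (n : ℤ) :
    planeElt n 0 * stableLetter σ = stableLetter σ * planeElt n (stableSign σ * n) := by
  have h1 : planeElt 1 (stableSign σ) =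
      (stableLetter σ)⁻¹ * planeElt 1 0 * stableLetter σ := by
    cases σ
    · simpa [stableSign, stableLetter, gen_eq_planeElt] using gersten_relations.2.2.2.2
    · simpa [stableSign, stableLetter, gen_eq_planeElt] using gersten_relations.2.2.2.1
  have h2 : planeElt n (stableSign σ * n) = planeElt 1 (stableSign σ) ^ n := by
    rw [planeElt_zpow]; ring_nf
  have h3 : planeElt n 0 = planeElt 1 0 ^ n := by rw [planeElt_zpow]; simp
  rw [h2, h1, h3]
  have := conj_zpow (a := (stableLetter σ)⁻¹) (b := planeElt 1 0) (i := n)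
  rw [inv_inv] at this
  rw [this]; group

/-- The letter of a crossing. -/
def crossLetter (σ up : Bool) : GerstenGroup :=
  if up then stableLetter σ else (stableLetter σ)⁻¹

theorem crossLetter_mul_not (σ up : Bool) : crossLetter σ up * crossLetter σ (!up) = 1 := by
  cases up <;> simp [crossLetter]

theorem planeElt_mul_crossLetter (σ up : Bool) (n : ℤ) :
    planeElt n (exitSlope σ up * n) * crossLetter σ up =
      crossLetter σ up * planeElt n (exitSlope σ (!up) * n) := by
  have := planeElt_mul_stableLetter σ n
  cases up
  · simp only [exitSlope, crossLetter, Bool.false_eq_true, if_false, Bool.not_false, if_true,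
      zero_mul]
    rw [eq_inv_mul_iff_mul_eq, ← mul_assoc, ← this, mul_inv_cancel_right]
  · simpa [exitSlope, crossLetter] using this

/-- The origin of the plane reached by a list of crossings, as an element of the group. -/
def stackElt : List Crossing → GerstenGroup
  | [] => 1
  | e :: r => stackElt r * planeElt 0 e.offset * crossLetter e.sgn e.up

/-- The element of the group that corresponds to a point. -/
def siteElt (p : ℤ × ℤ × List Crossing) : GerstenGroup := stackElt p.2.2 * planeElt p.1 p.2.1

/-- A stable letter is pulled through the part of the plane element that lies along the exit line;
what remains is a power of `b`, recorded as the offset. In the cancelling case the two stable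
letters become adjacent. -/
theorem siteElt_cross (σ up : Bool) (p : ℤ × ℤ × List Crossing) :
    siteElt (crossRaw σ up p) = siteElt p * crossLetter σ up := by
  have push : ∀ (x y : ℤ) (r : List Crossing),
      stackElt (⟨σ, up, y - exitSlope σ up * x⟩ :: r) * planeElt x (exitSlope σ (!up) * x) =
        stackElt r * planeElt x y * crossLetter σ up := by
    intro x y r
    simp only [stackElt]
    rw [mul_assoc, ← planeElt_mul_crossLetter, ← mul_assoc, mul_assoc (stackElt r), planeElt_mul]
    ring_nf
  obtain ⟨x, y, _ | ⟨⟨σ', up', k⟩, r⟩⟩ := p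
  · exact push x y []
  · simp only [crossRaw]
    split_ifs with hc
    · obtain ⟨rfl, h2, rfl⟩ := hc
      obtain rfl : up' = !up := h2
      simp only [siteElt, stackElt]
      rw [mul_assoc _ (planeElt x _) (crossLetter _ _), planeElt_mul_crossLetter, ← mul_assoc,
        mul_assoc _ (crossLetter σ' (!up)) (crossLetter σ' up)]
      have := crossLetter_mul_not σ' (!up)
      rw [Bool.not_not] at this
      rw [this, mul_one, mul_assoc, planeElt_mul]
      ring_nf
    · exact push x y _

theorem siteElt_shift (u v : ℤ) (p : Site) :
    siteElt (shift u v p).1 = siteElt p.1 * planeElt u v := by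
  simp [siteElt, shift, mul_assoc, planeElt_mul]

theorem siteElt_genAct (y : GerstenGen) (p : Site) :
    siteElt (genAct y p).1 = siteElt p.1 * presentedGens gerstenRels y := by
  obtain ⟨ha, hb, hc, hd⟩ := gen_eq_planeElt
  cases y
  · rw [ha]; exact siteElt_shift _ _ p
  · rw [hb]; exact siteElt_shift _ _ p
  · rw [hc]; exact siteElt_shift _ _ p
  · rw [hd]; exact siteElt_shift _ _ p
  · exact siteElt_cross true true p.1
  · exact siteElt_cross false true p.1

/-- Equivariance passes from the generators to the whole group. Applied to the origin it yields a
left inverse of `site`, so the points are normal forms. -/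
theorem siteElt_siteHom_inv (g : GerstenGroup) (p : Site) :
    siteElt ((siteHom g)⁻¹ p).1 = siteElt p.1 * g := by
  let H : Subgroup GerstenGroup :=
    { carrier := {g | ∀ p, siteElt ((siteHom g)⁻¹ p).1 = siteElt p.1 * g}
      one_mem' := by intro p; simp
      mul_mem' := by
        intro g h hg hh p
        simp only [Set.mem_ofPred_eq] at hg hh
        rw [map_mul, mul_inv_rev, Equiv.Perm.mul_apply, hh, hg, mul_assoc]
      inv_mem' := by
        intro g hg p
        simp only [Set.mem_ofPred_eq] at hg
        have := hg ((siteHom g) p)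
        rw [Equiv.Perm.inv_def, Equiv.symm_apply_apply] at this
        rw [map_inv, inv_inv, this, mul_inv_cancel_right] }
  refine PresentedGroup.generated_by gerstenRels H (fun y p => ?_) g p
  have := siteHom_gen y
  rw [presentedGens] at this
  rw [this, inv_inv]
  exact siteElt_genAct y p

theorem siteElt_site (g : GerstenGroup) : siteElt (site g).1 = g := by
  rw [site, siteElt_siteHom_inv]; simp [siteElt, originSite, stackElt, planeElt_zero]

theorem site_injective : Function.Injective site :=
  Function.LeftInverse.injective (g := fun p : Site => siteElt p.1) siteElt_site

/-! ### The word metric -/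

/-- The distance from the identity, computed along the planes. -/
noncomputable def height : List Crossing → ℤ → ℤ → ℕ
  | [], x, y => max x.natAbs y.natAbs
  | e :: r, x, y => ⨅ q : ℤ, (height r q (e.out * q + e.offset) + 1 +
      max (x - q).natAbs (y - e.inn * q).natAbs)

theorem height_cons_le (e : Crossing) (r : List Crossing) (x y q : ℤ) :
    height (e :: r) x y ≤ height r q (e.out * q + e.offset) + 1 +
      max (x - q).natAbs (y - e.inn * q).natAbs :=
  ciInf_le (OrderBot.bddBelow _) q

theorem exists_height_cons_eq (e : Crossing) (r : List Crossing) (x y : ℤ) :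
    ∃ q : ℤ, height (e :: r) x y = height r q (e.out * q + e.offset) + 1 +
      max (x - q).natAbs (y - e.inn * q).natAbs := by
  obtain ⟨q, hq⟩ := Nat.sInf_mem (Set.range_nonempty fun q : ℤ =>
    (height r q (e.out * q + e.offset) + 1 + max (x - q).natAbs (y - e.inn * q).natAbs))
  exact ⟨q, hq.symm⟩

theorem Crossing.out_cases (e : Crossing) : e.out = 0 ∨ e.out = 1 ∨ e.out = -1 :=
  exitSlope_cases _ _

theorem Crossing.inn_cases (e : Crossing) : e.inn = 0 ∨ e.inn = 1 ∨ e.inn = -1 :=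
  exitSlope_cases _ _

theorem height_le_add (st : List Crossing) (x y x' y' : ℤ) :
    height st x' y' ≤ height st x y + max (x' - x).natAbs (y' - y).natAbs := by
  cases st with
  | nil => simp only [height]; omega
  | cons e r =>
    obtain ⟨q, hq⟩ := exists_height_cons_eq e r x y
    have := height_cons_le e r x' y' q
    omega

/-- On lines of slope `0`, `1` or `-1` the sup distance is the difference of abscissas. The two
copies of the line are therefore isometric, and crossing elsewhere saves nothing. -/
theorem height_line (e : Crossing) (r : List Crossing) (q : ℤ) :
    height (e :: r) q (e.inn * q) = height r q (e.out * q + e.offset) + 1 := by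
  apply le_antisymm
  · simpa using height_cons_le e r q (e.inn * q) q
  · obtain ⟨q', hq'⟩ := exists_height_cons_eq e r q (e.inn * q)
    have := height_le_add r q' (e.out * q' + e.offset) q (e.out * q + e.offset)
    have h : (e.out * q + e.offset - (e.out * q' + e.offset)).natAbs ≤ (q - q').natAbs := by
      rcases e.out_cases with h | h | h <;> rw [h] <;> omega
    omega

/-- Adjacency of points, in a plane or across a line. -/
inductive SiteStep : ℤ × ℤ × List Crossing → ℤ × ℤ × List Crossing → Prop
  | plane (x y x' y' : ℤ) (st : List Crossing) (hx : (x' - x).natAbs ≤ 1)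
      (hy : (y' - y).natAbs ≤ 1) : SiteStep (x, y, st) (x', y', st)
  | enter (x : ℤ) (e : Crossing) (r : List Crossing) :
      SiteStep (x, e.out * x + e.offset, r) (x, e.inn * x, e :: r)
  | leave (x : ℤ) (e : Crossing) (r : List Crossing) :
      SiteStep (x, e.inn * x, e :: r) (x, e.out * x + e.offset, r)

theorem SiteStep.symm {p q : ℤ × ℤ × List Crossing} (h : SiteStep p q) : SiteStep q p := by
  cases h with
  | plane x y x' y' st hx hy => exact .plane _ _ _ _ _ (by omega) (by omega)
  | enter x e r => exact .leave x e r
  | leave x e r => exact .enter x e r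

theorem SiteStep.height_le {p q : ℤ × ℤ × List Crossing} (h : SiteStep p q) :
    height q.2.2 q.1 q.2.1 ≤ height p.2.2 p.1 p.2.1 + 1 := by
  cases h with
  | plane x y x' y' st hx hy =>
    have := height_le_add st x y x' y'
    simp only; omega
  | enter x e r => exact (height_line e r x).le
  | leave x e r => have := height_line e r x; simp only; omega

theorem siteStep_cross (σ up : Bool) (p : ℤ × ℤ × List Crossing) :
    SiteStep p (crossRaw σ up p) := by
  have push : ∀ x y r, SiteStep (x, y, r)
      (x, exitSlope σ (!up) * x, ⟨σ, up, y - exitSlope σ up * x⟩ :: r) := by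
    intro x y r
    have := SiteStep.enter x ⟨σ, up, y - exitSlope σ up * x⟩ r
    simpa [Crossing.out, Crossing.inn] using this
  obtain ⟨x, y, _ | ⟨⟨σ', up', k⟩, r⟩⟩ := p
  · exact push x y []
  · simp only [crossRaw]
    split_ifs with hc
    · obtain ⟨rfl, h2, rfl⟩ := hc
      obtain rfl : up' = !up := h2
      have := SiteStep.leave x ⟨σ', !up, k⟩ r
      simpa [Crossing.out, Crossing.inn] using this
    · exact push x y _

theorem siteStep_genAct (y : GerstenGen) (p : Site) : SiteStep p.1 (genAct y p).1 := by
  cases y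
  case s => exact siteStep_cross true true p.1
  case t => exact siteStep_cross false true p.1
  all_goals exact .plane _ _ _ _ _ (by simp) (by simp)

/-- The element of the group spelled by a word. -/
abbrev gersVal (w : List (GerstenGen × Bool)) : GerstenGroup :=
  wordVal (presentedGens gerstenRels) w

theorem wordVal_nil {G ι : Type*} [Group G] (x : ι → G) : wordVal x [] = 1 := by simp [wordVal]

theorem wordVal_cons {G ι : Type*} [Group G] (x : ι → G) (l : ι × Bool) (w : List (ι × Bool)) :
    wordVal x (l :: w) = wordVal x [l] * wordVal x w := by simp [wordVal]

theorem wordVal_append {G ι : Type*} [Group G] (x : ι → G) (w w' : List (ι × Bool)) :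
    wordVal x (w ++ w') = wordVal x w * wordVal x w' := by simp [wordVal]

theorem siteStep_letter (g : GerstenGroup) (l : GerstenGen × Bool) :
    SiteStep (site g).1 (site (g * gersVal [l])).1 := by
  have key : ∀ g y, SiteStep (site g).1 (site (g * presentedGens gerstenRels y)).1 := by
    intro g y
    rw [site_mul, siteHom_gen, inv_inv]
    exact siteStep_genAct y _
  obtain ⟨y, b⟩ := l
  cases b
  · have := (key (g * (presentedGens gerstenRels y)⁻¹) y).symm
    simpa [gersVal, wordVal] using this
  · simpa [gersVal, wordVal] using key g y

/-- The distance of a point of the Cayley graph to the identity. -/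
noncomputable def siteHeight (g : GerstenGroup) : ℕ :=
  height (site g).1.2.2 (site g).1.1 (site g).1.2.1

theorem siteHeight_mul_le (w : List (GerstenGen × Bool)) :
    ∀ g : GerstenGroup, siteHeight (g * gersVal w) ≤ siteHeight g + w.length := by
  induction w with
  | nil => intro g; simp [gersVal, wordVal_nil]
  | cons l w ih =>
    intro g
    have h1 := ih (g * gersVal [l])
    have h2 := (siteStep_letter g l).height_le
    have h3 : g * gersVal (l :: w) = g * gersVal [l] * gersVal w := by
      rw [gersVal, wordVal_cons, mul_assoc]
    rw [h3, List.length_cons]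
    simp only [siteHeight] at *
    omega

/-- The eight letters of the plane and their inverses are exactly the king moves of the lattice,
which is why the metric of a plane is the sup norm. -/
theorem exists_letter_plane (u v : ℤ) (hu : u.natAbs ≤ 1) (hv : v.natAbs ≤ 1)
    (h : ¬ (u = 0 ∧ v = 0)) : ∃ l, gersVal [l] = planeElt u v := by
  obtain ⟨ha, hb, hc, hd⟩ := gen_eq_planeElt
  have hu' : u = 0 ∨ u = 1 ∨ u = -1 := by omega
  have hv' : v = 0 ∨ v = 1 ∨ v = -1 := by omega
  have pos : ∀ y, gersVal [(y, true)] = presentedGens gerstenRels y := by simp [gersVal, wordVal]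
  have neg : ∀ y, gersVal [(y, false)] = (presentedGens gerstenRels y)⁻¹ := by
    simp [gersVal, wordVal]
  rcases hu' with rfl | rfl | rfl <;> rcases hv' with rfl | rfl | rfl
  · simp at h
  · exact ⟨(.b, true), by rw [pos, hb]⟩
  · exact ⟨(.b, false), by rw [neg, hb, planeElt_inv]; simp⟩
  · exact ⟨(.a, true), by rw [pos, ha]⟩
  · exact ⟨(.c, true), by rw [pos, hc]⟩
  · exact ⟨(.d, true), by rw [pos, hd]⟩
  · exact ⟨(.a, false), by rw [neg, ha, planeElt_inv]; simp⟩
  · exact ⟨(.d, false), by rw [neg, hd, planeElt_inv]; simp⟩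
  · exact ⟨(.c, false), by rw [neg, hc, planeElt_inv]⟩

theorem exists_word_plane (n : ℕ) : ∀ x y : ℤ, max x.natAbs y.natAbs ≤ n →
    ∃ w : List (GerstenGen × Bool), gersVal w = planeElt x y ∧ w.length ≤ n := by
  induction n with
  | zero =>
    intro x y h
    obtain rfl : x = 0 := by omega
    obtain rfl : y = 0 := by omega
    exact ⟨[], by simp [gersVal, wordVal_nil, planeElt_zero], le_rfl⟩
  | succ n ih =>
    intro x y h
    by_cases h0 : x = 0 ∧ y = 0
    · obtain ⟨rfl, rfl⟩ := h0
      exact ⟨[], by simp [gersVal, wordVal_nil, planeElt_zero], by simp⟩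
    · have hs : ∀ z : ℤ, z.natAbs ≤ n + 1 → ∃ u : ℤ, u.natAbs ≤ 1 ∧ (z - u).natAbs ≤ n ∧
          (u = 0 → z = 0) := by
        intro z hz
        rcases lt_trichotomy z 0 with h | h | h
        · exact ⟨-1, by omega, by omega, by omega⟩
        · exact ⟨0, by omega, by omega, by omega⟩
        · exact ⟨1, by omega, by omega, by omega⟩
      obtain ⟨u, hu1, hu2, hu3⟩ := hs x (by omega)
      obtain ⟨v, hv1, hv2, hv3⟩ := hs y (by omega)
      obtain ⟨l, hl⟩ := exists_letter_plane u v hu1 hv1 (by tauto)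
      obtain ⟨w, hw, hwl⟩ := ih (x - u) (y - v) (by omega)
      refine ⟨l :: w, ?_, by simpa using hwl⟩
      rw [gersVal, wordVal_cons, ← gersVal, ← gersVal, hl, hw, planeElt_mul]
      congr 1 <;> ring

theorem exists_letter_cross (σ up : Bool) : ∃ l, gersVal [l] = crossLetter σ up := by
  cases σ <;> cases up
  · exact ⟨(.t, false), by simp [gersVal, wordVal, crossLetter, stableLetter]⟩
  · exact ⟨(.t, true), by simp [gersVal, wordVal, crossLetter, stableLetter]⟩
  · exact ⟨(.s, false), by simp [gersVal, wordVal, crossLetter, stableLetter]⟩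
  · exact ⟨(.s, true), by simp [gersVal, wordVal, crossLetter, stableLetter]⟩

theorem siteElt_enter (x : ℤ) (e : Crossing) (r : List Crossing) :
    siteElt (x, e.inn * x, e :: r) =
      siteElt (x, e.out * x + e.offset, r) * crossLetter e.sgn e.up := by
  simp only [siteElt, stackElt, Crossing.inn, Crossing.out]
  rw [mul_assoc _ (crossLetter _ _), ← planeElt_mul_crossLetter, ← mul_assoc,
    mul_assoc (stackElt r), planeElt_mul]
  ring_nf

theorem siteElt_plane (x y u v : ℤ) (st : List Crossing) :
    siteElt (x + u, y + v, st) = siteElt (x, y, st) * planeElt u v := by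
  simp [siteElt, mul_assoc, planeElt_mul]

theorem exists_word_height (st : List Crossing) : ∀ x y : ℤ,
    ∃ w : List (GerstenGen × Bool), gersVal w = siteElt (x, y, st) ∧
      w.length ≤ height st x y := by
  induction st with
  | nil =>
    intro x y
    obtain ⟨w, hw, hl⟩ := exists_word_plane _ x y le_rfl
    exact ⟨w, by simp [hw, siteElt, stackElt], hl⟩
  | cons e r ih =>
    intro x y
    obtain ⟨q, hq⟩ := exists_height_cons_eq e r x y
    obtain ⟨w, hw, hl⟩ := ih q (e.out * q + e.offset)
    obtain ⟨l, hl'⟩ := exists_letter_cross e.sgn e.up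
    obtain ⟨w', hw', hl''⟩ := exists_word_plane _ (x - q) (y - e.inn * q) le_rfl
    refine ⟨w ++ l :: w', ?_, by simp only [List.length_append, List.length_cons]; omega⟩
    rw [gersVal, wordVal_append, wordVal_cons, ← gersVal, ← gersVal, ← gersVal, hw, hl', hw',
      ← mul_assoc, ← siteElt_enter, ← siteElt_plane]
    congr 2
    · ring
    · ring_nf

/-- One letter changes the height by at most one, and optimal crossing points assemble to a word
whose length is at most the height. -/
theorem wordDist_one_le_iff (g : GerstenGroup) (N : ℕ) :
    wordDist (presentedGens gerstenRels) 1 g ≤ N ↔ siteHeight g ≤ N := by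
  rw [wordDist_le_iff]
  constructor
  · rintro ⟨w, hw, hl⟩
    have := siteHeight_mul_le w 1
    rw [hw] at this
    have h1 : siteHeight 1 = 0 := by simp [siteHeight, site_one, originSite, height]
    omega
  · intro h
    obtain ⟨w, hw, hl⟩ := exists_word_height (site g).1.2.2 (site g).1.1 (site g).1.2.1
    exact ⟨w, by rw [one_mul]; exact hw.trans (siteElt_site g), hl.trans h⟩

theorem site_mul_planeElt (g : GerstenGroup) (u v : ℤ) :
    site (g * planeElt u v) = shift u v (site g) := by
  have zp : ∀ u v n : ℤ, shift u v ^ n = shift (n * u) (n * v) := by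
    intro u v n
    have hm : ∀ u v u' v', shift u v * shift u' v' = shift (u + u') (v + v') := by
      intro u v u' v'; ext p <;> simp [shift] <;> ring
    have hi : ∀ u v, (shift u v)⁻¹ = shift (-u) (-v) := by
      intro u v; rw [inv_eq_iff_mul_eq_one, hm]; ext p <;> simp [shift]
    induction n with
    | zero => ext p <;> simp [shift]
    | succ n ih => rw [zpow_add_one, ih, hm]; ring_nf
    | pred n ih => rw [zpow_sub_one, ih, hi, hm]; ring_nf
  rw [site_mul, planeElt, map_mul, map_zpow, map_zpow, siteHom_gen, siteHom_gen, mul_inv_rev,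
    inv_zpow, inv_zpow, inv_inv, inv_inv, genAct, genAct, zp, zp]
  apply Subtype.ext
  simp [shift]

/-- The planes are isometrically embedded. -/
theorem plane_isometric {g : GerstenGroup} {w : List (GerstenGen × Bool)} {x y x' y' : ℤ}
    {st : List Crossing} (h : (site g).1 = (x, y, st))
    (h' : (site (g * gersVal w)).1 = (x', y', st)) :
    max (x' - x).natAbs (y' - y).natAbs ≤ w.length := by
  -- Two points of one plane differ by an element of the base plane, so the word can be based at the
  -- identity, where the height is the sup norm.
  have h1 : gersVal w = planeElt (x' - x) (y' - y) := by
    have e1 := siteElt_site g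
    have e2 := siteElt_site (g * gersVal w)
    rw [h] at e1
    rw [h'] at e2
    have := siteElt_plane x y (x' - x) (y' - y) st
    rw [add_sub_cancel, add_sub_cancel, e1, e2] at this
    exact mul_left_cancel this
  have h2 := siteHeight_mul_le w 1
  rw [h1, siteHeight, siteHeight, site_mul_planeElt, site_one] at h2
  simpa [shift, originSite, height] using h2

/-! ### Discretely convex functions on the integers -/

/-- A `1`-Lipschitz function whose increments over the windows of each dyadic length are
nondecreasing up to an error of `1`. -/
structure DyadicConvex (f : ℤ → ℤ) : Prop where
  lip : ∀ i, (f (i + 1) - f i).natAbs ≤ 1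
  bal : ∀ (n : ℕ) (i j : ℤ), i ≤ j → f (i + 2 ^ n) - f i ≤ f (j + 2 ^ n) - f j + 1

namespace DyadicConvex

variable {f : ℤ → ℤ}

theorem lipschitz (hf : DyadicConvex f) (i j : ℤ) : (f j - f i).natAbs ≤ (j - i).natAbs := by
  have key : ∀ i j, i ≤ j → (f j - f i).natAbs ≤ (j - i).natAbs := by
    intro i j hij
    induction j, hij using Int.leInduction with
    | base => simp
    | succ j hij ih => have := hf.lip j; omega
  rcases le_total i j with h | h
  · exact key i j h
  · have := key j i h; omega

theorem comp_add (hf : DyadicConvex f) (a c : ℤ) : DyadicConvex fun q => f (q + a) + c where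
  lip i := by have := hf.lip (i + a); rw [add_right_comm] at this; omega
  bal n i j hij := by
    have := hf.bal n (i + a) (j + a) (by omega)
    rw [add_right_comm, add_right_comm j] at this; omega

theorem comp_neg (hf : DyadicConvex f) : DyadicConvex fun q => f (-q) where
  lip i := by
    have := hf.lip (-(i + 1)); rw [neg_add, neg_add_cancel_right] at *; omega
  bal n i j hij := by
    have := hf.bal n (-(j + 2 ^ n)) (-(i + 2 ^ n)) (by omega)
    rw [neg_add, neg_add, neg_add_cancel_right, neg_add_cancel_right] at *; omega

theorem of_convex (h1 : ∀ i, (f (i + 1) - f i).natAbs ≤ 1)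
    (h2 : ∀ L i j : ℤ, 0 ≤ L → i ≤ j → f (i + L) - f i ≤ f (j + L) - f j) : DyadicConvex f where
  lip := h1
  bal n i j hij := by have := h2 (2 ^ n) i j (by positivity) hij; omega

/-- Each minimum is attained at one of two adjacent points, so four pairs of shifted windows have to
be compared. For `i < j` each pair is still in order; equality is treated apart because the window
at `i + 1` would come after the one at `j`. -/
theorem min_succ (hf : DyadicConvex f) : DyadicConvex fun q => min (f q) (f (q + 1)) where
  lip i := by have := hf.lip i; have := hf.lip (i + 1); omega
  bal n i j hij := by
    rcases hij.eq_or_lt with rfl | hij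
    · omega
    have h1 := hf.bal n i j (by omega)
    have h2 := hf.bal n (i + 1) j (by omega)
    have h3 := hf.bal n i (j + 1) (by omega)
    have h4 := hf.bal n (i + 1) (j + 1) (by omega)
    rw [add_right_comm] at h2 h4
    rw [add_right_comm] at h3
    rw [add_right_comm j] at h4
    omega

theorem exists_lt_succ {i j : ℤ} (hij : i ≤ j) (h : f i < f j) :
    ∃ l, i ≤ l ∧ l < j ∧ f l < f (l + 1) := by
  induction j, hij using Int.leInduction with
  | base => omega
  | succ j hij ih =>
    by_cases hj : f j < f (j + 1)
    · exact ⟨j, hij, by omega, hj⟩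
    · obtain ⟨l, h1, h2, h3⟩ := ih (by omega)
      exact ⟨l, h1, by omega, h3⟩

theorem exists_succ_lt {i j : ℤ} (hij : i ≤ j) (h : f j < f i) :
    ∃ l, i ≤ l ∧ l < j ∧ f (l + 1) < f l := by
  obtain ⟨l, h1, h2, h3⟩ := exists_lt_succ (f := fun q => -f q) hij (by simpa using h)
  exact ⟨l, h1, h2, by simpa using h3⟩

/-- The balance condition for windows of length `1` excludes a step `+1` followed later by a step
`-1`, and an interior value above both ends would produce such a pair. -/
theorem le_max (hf : DyadicConvex f) {i l j : ℤ} (h1 : i ≤ l) (h2 : l ≤ j) :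
    f l ≤ max (f i) (f j) := by
  by_contra! h
  obtain ⟨p, hp1, hp2, hp3⟩ := exists_lt_succ h1 (lt_of_le_of_lt (le_max_left _ _) h)
  obtain ⟨q, hq1, hq2, hq3⟩ := exists_succ_lt h2 (lt_of_le_of_lt (le_max_right _ _) h)
  have := hf.bal 0 p q (by omega)
  simp only [pow_zero] at this
  omega

theorem antitone_left (hf : DyadicConvex f) {μ i j : ℤ} (hμ : ∀ q, f μ ≤ f q) (h1 : i ≤ j)
    (h2 : j ≤ μ) : f j ≤ f i := by
  have := hf.le_max h1 h2
  have := hμ i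
  omega

/-- The function whose values at even and odd integers come from the values of `f` at integers and
at pairs of adjacent integers. -/
theorem interleave {F : ℤ → ℤ} (hf : DyadicConvex f) (h0 : ∀ j, F (2 * j) = f j + j.natAbs)
    (h1 : ∀ j, F (2 * j + 1) = min (f j) (f (j + 1)) + max (j + 1) (-j)) : DyadicConvex F := by
  have split : ∀ i : ℤ, ∃ j, i = 2 * j ∨ i = 2 * j + 1 := fun i => ⟨i / 2, by omega⟩
  have lip : ∀ i, (F (i + 1) - F i).natAbs ≤ 1 ∧ (0 ≤ i → F i ≤ F (i + 1)) ∧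
      (i < 0 → F (i + 1) ≤ F i) := by
    intro i
    obtain ⟨j, rfl | rfl⟩ := split i
    · have := hf.lip j
      rw [h0, h1]; omega
    · have := hf.lip j
      have e : 2 * j + 1 + 1 = 2 * (j + 1) := by ring
      rw [e, h0, h1]; omega
  refine ⟨fun i => (lip i).1, ?_⟩
  intro n i j hij
  cases n with
  -- Unit windows need no balance of `f`: `F` does not increase to the left of `0` and does not
  -- decrease to the right of it.
  | zero =>
    simp only [pow_zero]
    have := lip i
    have := lip j
    omega
  | succ n =>
    have hL : (0 : ℤ) < 2 ^ n := by positivity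
    have hp : (2 : ℤ) ^ (n + 1) = 2 * 2 ^ n := by ring
    -- A window of length `2 * 2 ^ n` of `F` covers a window of length `2 ^ n` of `f`.
    have hC := hf.bal n
    rw [hp]
    generalize (2 : ℤ) ^ n = L at *
    have e0 : ∀ i, F (2 * i + 2 * L) = f (i + L) + (i + L).natAbs := by
      intro i; rw [← mul_add, h0]
    have e1 : ∀ i, F (2 * i + 1 + 2 * L) =
        min (f (i + L)) (f (i + 1 + L)) + max (i + L + 1) (-(i + L)) := by
      intro i
      have : 2 * i + 1 + 2 * L = 2 * (i + L) + 1 := by ring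
      rw [this, h1, add_right_comm i L 1]
    obtain ⟨i, rfl | rfl⟩ := split i <;> obtain ⟨j, rfl | rfl⟩ := split j
    · have := hC i j (by omega)
      rw [e0, e0, h0, h0]; omega
    · have := hC i j (by omega)
      have := hC i (j + 1) (by omega)
      rw [e0, e1, h0, h1]; omega
    · have := hC i j (by omega)
      have := hC (i + 1) j (by omega)
      rw [e1, e0, h1, h0]; omega
    · rcases eq_or_ne i j with rfl | hne
      · omega
      have := hC i j (by omega)
      have := hC (i + 1) j (by omega)
      have := hC i (j + 1) (by omega)
      have := hC (i + 1) (j + 1) (by omega)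
      rw [e1, e1, h1, h1]; omega

end DyadicConvex

/-! ### The distance function of a plane in terms of its values on one line -/

/-- `D` is the infimal convolution of the sup norm with the function that is `f` on the line of
slope `m` through the origin. -/
structure InfConv (f : ℤ → ℤ) (m : ℤ) (D : ℤ → ℤ → ℤ) : Prop where
  le : ∀ x y q, D x y ≤ f q + max (x - q).natAbs (y - m * q).natAbs
  exists_eq : ∀ x y, ∃ q, D x y = f q + max (x - q).natAbs (y - m * q).natAbs

namespace InfConv

variable {f : ℤ → ℤ} {m : ℤ} {D : ℤ → ℤ → ℤ}

section Horizontal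

theorem comp_add (hD : InfConv f 0 D) (o : ℤ) :
    InfConv (fun q => f (q + o)) 0 fun x y => D (x + o) y where
  le x y q := by have := hD.le (x + o) y (q + o); omega
  exists_eq x y := by
    obtain ⟨q, hq⟩ := hD.exists_eq (x + o) y
    exact ⟨q - o, by simp only [sub_add_cancel]; omega⟩

theorem comp_neg (hD : InfConv f 0 D) : InfConv (fun q => f (-q)) 0 fun x y => D (-x) y where
  le x y q := by have := hD.le (-x) y (-q); omega
  exists_eq x y := by
    obtain ⟨q, hq⟩ := hD.exists_eq (-x) y
    exact ⟨-q, by simp only [neg_neg]; omega⟩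

theorem neg_right (hD : InfConv f 0 D) (x y : ℤ) : D x (-y) = D x y := by
  obtain ⟨q, hq⟩ := hD.exists_eq x y
  obtain ⟨q', hq'⟩ := hD.exists_eq x (-y)
  have := hD.le x y q'
  have := hD.le x (-y) q
  omega

theorem mono_right (hD : InfConv f 0 D) (x : ℤ) {y y' : ℤ} (h : y.natAbs ≤ y'.natAbs) :
    D x y ≤ D x y' := by
  obtain ⟨q, hq⟩ := hD.exists_eq x y'
  have := hD.le x y q
  omega

/-- The last king move away from the line comes from one of three neighbours in the previous row.
Writing the minimum of three as an iterated minimum of pairs lets `DyadicConvex.min_succ` be applied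
twice. -/
theorem row_succ (hD : InfConv f 0 D) (x : ℤ) (k : ℕ) :
    D x (k + 1) = min (min (D (x - 1) k) (D (x - 1 + 1) k))
      (min (D (x - 1 + 1) k) (D (x - 1 + 1 + 1) k)) + 1 := by
  rw [sub_add_cancel]
  have upper : ∀ u : ℤ, u.natAbs ≤ 1 → D x (k + 1) ≤ D (x + u) k + 1 := by
    intro u hu
    obtain ⟨q, hq⟩ := hD.exists_eq (x + u) k
    have := hD.le x (k + 1) q
    omega
  have lower : D (x + -1) k + 1 ≤ D x (k + 1) ∨ D (x + 0) k + 1 ≤ D x (k + 1) ∨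
      D (x + 1) k + 1 ≤ D x (k + 1) := by
    obtain ⟨q, hq⟩ := hD.exists_eq x (k + 1)
    rcases lt_trichotomy q x with h | h | h
    · have := hD.le (x + -1) k q; omega
    · have := hD.le (x + 0) k q; omega
    · have := hD.le (x + 1) k q; omega
  have h1 := upper (-1) (by simp)
  have h2 := upper 0 (by simp)
  have h3 := upper 1 (by simp)
  rw [← sub_eq_add_neg, add_zero] at *
  omega

theorem balanced_row (hD : InfConv f 0 D) (hf : DyadicConvex f) (k : ℤ) :
    DyadicConvex fun x => D x k := by
  have key : ∀ k : ℕ, DyadicConvex fun x => D x k := by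
    intro k
    induction k with
    | zero =>
      convert hf using 2 with x
      obtain ⟨q, hq⟩ := hD.exists_eq x 0
      have := hD.le x 0 x
      have := hf.lipschitz q x
      simp only [Nat.cast_zero]
      omega
    | succ k ih =>
      have := (ih.min_succ.min_succ.comp_add (-1) 1)
      convert this using 2 with x
      have := hD.row_succ x k
      push_cast
      rw [this]
      rfl
  rcases Int.eq_nat_or_neg k with ⟨n, rfl | rfl⟩
  · exact key n
  · simpa only [hD.neg_right] using key n

/-- For `y ≥ 0`, every crossing abscissa in `[0, 2y]` is at sup distance `y` from `(y, y)`, and `f`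
does not increase up to its minimizer `μ`; hence the best choice is `min (2 * y) μ`. For `y ≤ 0` it
is `0`. Windows of length `L` on the diagonal thus correspond to windows of length `2L` of `f`. -/
theorem balanced_diag_of_argmin (hD : InfConv f 0 D) (hf : DyadicConvex f) {μ : ℤ}
    (hμ : ∀ q, f μ ≤ f q) (h0 : 0 ≤ μ) : DyadicConvex fun y => D y y := by
  set T := fun y => D y y with hT
  have hpos : ∀ y, 0 ≤ y → T y = y + f (min (2 * y) μ) := by
    intro y hy
    obtain ⟨q, hq⟩ := hD.exists_eq y y
    have h1 := hD.le y y (min (2 * y) μ)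
    have h2 := hμ q
    have h3 : q ≤ min (2 * y) μ → f (min (2 * y) μ) ≤ f q :=
      fun h => hf.antitone_left hμ h (min_le_right _ _)
    have h4 := hf.lipschitz (min (2 * y) μ) q
    have h5 : min (2 * y) μ = 2 * y ∨ min (2 * y) μ = μ := by omega
    simp only [hT]
    rcases h5 with h5 | h5 <;> rw [h5] at h1 h3 h4 ⊢ <;> omega
  have hneg : ∀ y, y ≤ 0 → T y = -y + f 0 := by
    intro y hy
    obtain ⟨q, hq⟩ := hD.exists_eq y y
    have h1 := hD.le y y 0
    have h3 : q ≤ 0 → f 0 ≤ f q := fun h => hf.antitone_left hμ h h0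
    have h4 := hf.lipschitz 0 q
    simp only [hT]
    omega
  have lip : ∀ i j, (T j - T i).natAbs ≤ (j - i).natAbs := by
    have step : ∀ i, (T (i + 1) - T i).natAbs ≤ 1 := by
      intro i
      rcases lt_or_ge i 0 with h | h
      · rw [hneg i (by omega), hneg (i + 1) (by omega)]; omega
      · rw [hpos i h, hpos (i + 1) (by omega)]
        have h1 := hf.lipschitz (min (2 * i) μ) (min (2 * (i + 1)) μ)
        have h2 := hf.antitone_left (i := min (2 * i) μ) (j := min (2 * (i + 1)) μ) hμ
          (by omega) (by omega)
        omega
    have key : ∀ i j, i ≤ j → (T j - T i).natAbs ≤ (j - i).natAbs := by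
      intro i j hij
      induction j, hij using Int.leInduction with
      | base => simp
      | succ j hij ih => have := step j; omega
    intro i j
    rcases le_total i j with h | h
    · exact key i j h
    · have := key j i h; omega
  refine ⟨fun i => by have := lip i (i + 1); omega, ?_⟩
  intro n i j hij
  have hL : (0 : ℤ) < 2 ^ n := by positivity
  have hp : (2 : ℤ) ^ (n + 1) = 2 * 2 ^ n := by ring
  have hC := hf.bal (n + 1)
  rw [hp] at hC
  generalize (2 : ℤ) ^ n = L at *
  -- If the left window ends at or before `0` its increment is `-L`, the smallest possible; if the
  -- right window starts beyond `μ / 2` its increment is `L`, the largest possible.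
  by_cases c1 : i + L ≤ 0
  · have := lip j (j + L)
    rw [hneg i (by omega), hneg (i + L) c1]; omega
  by_cases c2 : μ ≤ 2 * j
  · have := lip i (i + L)
    rw [hpos j (by omega), hpos (j + L) (by omega), min_eq_right c2,
      min_eq_right (by omega : μ ≤ 2 * (j + L))]
    omega
  have ei := hpos (i + L) (by omega)
  have ej := hpos (j + L) (by omega)
  rcases lt_or_ge j 0 with hj | hj
  · have := hf.lipschitz (min (2 * (i + L)) μ) (min (2 * (j + L)) μ)
    rw [ei, ej, hneg i (by omega), hneg j (by omega)]
    omega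
  have hLHS : T (i + L) - T i ≤ L + f (min (2 * i + 2 * L) μ) - f (2 * i) := by
    rw [ei, mul_add]
    rcases lt_or_ge i 0 with hi | hi
    · have := hf.lipschitz (2 * i) 0
      rw [hneg i (by omega)]; omega
    · rw [hpos i hi, min_eq_left (by omega : 2 * i ≤ μ)]; omega
  rw [ej, hpos j hj, min_eq_left (by omega : 2 * j ≤ μ), mul_add]
  rcases le_total (2 * j + 2 * L) μ with h1 | h1
  · rw [min_eq_left (by omega)] at hLHS
    rw [min_eq_left h1]
    have := hC (2 * i) (2 * j) (by omega)
    omega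
  · rw [min_eq_right h1]
    rcases le_total (2 * i + 2 * L) μ with h2 | h2
    · rw [min_eq_left h2] at hLHS
      -- The clamped right window is compared with the window of `f` of full length that ends at
      -- `μ`.
      have h3 := hC (2 * i) (μ - 2 * L) (by omega)
      rw [sub_add_cancel] at h3
      have := hf.antitone_left (i := μ - 2 * L) (j := 2 * j) hμ (by omega) (by omega)
      omega
    · rw [min_eq_right h2] at hLHS
      have := hf.antitone_left (i := 2 * i) (j := 2 * j) hμ (by omega) (by omega)
      omega

/-- A minimizer exists because the values are nonnegative integers, and a reflection brings it to
the right of `0`. -/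
theorem balanced_diag (hD : InfConv f 0 D) (hf : DyadicConvex f) (h0 : ∀ q, 0 ≤ f q) :
    DyadicConvex fun y => D y y := by
  obtain ⟨μ, hμ⟩ : ∃ μ, ∀ q, f μ ≤ f q := by
    obtain ⟨_, ⟨μ, rfl⟩, h⟩ := WellFounded.has_min (measure fun z : ℤ => z.toNat).wf
      (Set.range f) ⟨_, 0, rfl⟩
    refine ⟨μ, fun q => ?_⟩
    have := h (f q) ⟨q, rfl⟩
    have := h0 q
    have := h0 μ
    change ¬ (f q).toNat < (f μ).toNat at *
    omega
  rcases le_total 0 μ with h | h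
  · exact hD.balanced_diag_of_argmin hf hμ h
  · have := hD.comp_neg.balanced_diag_of_argmin hf.comp_neg (μ := -μ)
      (by simpa using fun q => hμ (-q)) (by omega)
    convert this.comp_neg using 2 with y
    rw [neg_neg, hD.neg_right]

theorem balanced_line_of_slope_zero (hD : InfConv f 0 D) (hf : DyadicConvex f) (h0 : ∀ q, 0 ≤ f q)
    (m' k : ℤ) (hm' : m' = 0 ∨ m' = 1 ∨ m' = -1) : DyadicConvex fun q => D q (m' * q + k) := by
  rcases hm' with rfl | rfl | rfl
  · simpa using hD.balanced_row hf k
  · have := ((hD.comp_add (-k)).balanced_diag (by simpa using hf.comp_add (-k) 0)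
      (fun q => h0 _)).comp_add k 0
    convert this using 2 with q
    ring_nf
  · have := ((hD.comp_add k).comp_neg.balanced_diag (by simpa using (hf.comp_add k 0).comp_neg)
      (fun q => h0 _)).comp_add k 0 |>.comp_neg
    convert this using 2 with q
    ring_nf

end Horizontal

section Diagonal

/-- In the coordinates `p` along the line and `v` across it, the sup distance to the point of the
line with abscissa `q` is `|p - q| + |v|`. Since `f` is `1`-Lipschitz, the foot `q = p` is optimal.
-/
theorem apply_even (hD : InfConv f m D) (hm : m = 1 ∨ m = -1) (hf : DyadicConvex f) (p v : ℤ) :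
    D (p + v) (m * (p - v)) = f p + v.natAbs := by
  obtain ⟨q, hq⟩ := hD.exists_eq (p + v) (m * (p - v))
  have h1 := hD.le (p + v) (m * (p - v)) p
  have h2 := hf.lipschitz q p
  rcases hm with rfl | rfl <;> omega

/-- A lattice point of the other parity lies halfway between two feet, and the Lipschitz condition
reduces every crossing to one of these. -/
theorem apply_odd (hD : InfConv f m D) (hm : m = 1 ∨ m = -1) (hf : DyadicConvex f) (p v : ℤ) :
    D (p + v + 1) (m * (p - v)) = min (f p) (f (p + 1)) + max (v + 1) (-v) := by
  have upper : D (p + v + 1) (m * (p - v)) ≤ f p + max (v + 1) (-v) ∧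
      D (p + v + 1) (m * (p - v)) ≤ f (p + 1) + max (v + 1) (-v) := by
    have h1 := hD.le (p + v + 1) (m * (p - v)) p
    have h2 := hD.le (p + v + 1) (m * (p - v)) (p + 1)
    constructor
    · rcases hm with rfl | rfl <;> omega
    · rcases hm with rfl | rfl <;> omega
  obtain ⟨q, hq⟩ := hD.exists_eq (p + v + 1) (m * (p - v))
  have hA : p + v + 1 - q ≤ D (p + v + 1) (m * (p - v)) - f q ∧
      q - p - v - 1 ≤ D (p + v + 1) (m * (p - v)) - f q ∧
      p - v - q ≤ D (p + v + 1) (m * (p - v)) - f q ∧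
      q - p + v ≤ D (p + v + 1) (m * (p - v)) - f q := by
    rcases hm with rfl | rfl <;> refine ⟨?_, ?_, ?_, ?_⟩ <;> omega
  have h2 := hf.lipschitz q p
  have h3 := hf.lipschitz q (p + 1)
  generalize D (p + v + 1) (m * (p - v)) = A at *
  clear hq
  rcases le_or_gt q p with h | h
  · have : f p ≤ f q + (p - q) := by omega
    omega
  · have : f (p + 1) ≤ f q + (q - p - 1) := by omega
    omega

/-- A horizontal line meets the two parities alternately, which is the situation of
`DyadicConvex.interleave`. A line parallel to the entry line has one parity and carries a translate
of `f`, or of its minimum over adjacent points, plus a constant. On a line of the opposite slope the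
foot is fixed and the function is an absolute value or its half-integral analogue, up to a constant.
-/
theorem balanced_line_of_slope_one (hD : InfConv f m D) (hm : m = 1 ∨ m = -1) (hf : DyadicConvex f)
    (m' k : ℤ) (hm' : m' = 0 ∨ m' = m ∨ m' = -m) : DyadicConvex fun q => D q (m' * q + k) := by
  have hmm : m * m = 1 := by rcases hm with rfl | rfl <;> rfl
  obtain ⟨κ, rfl⟩ : ∃ κ, k = m * κ := ⟨m * k, by rw [← mul_assoc, hmm, one_mul]⟩
  have even := hD.apply_even hm hf
  have odd := hD.apply_odd hm hf
  rcases hm' with rfl | rfl | rfl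
  · have := ((hf.comp_add κ 0).interleave (F := fun x => D (x + κ) (m * κ)) (fun j => ?_)
      (fun j => ?_)).comp_add (-κ) 0
    · convert this using 2 with q
      ring_nf
    · have := even (j + κ) j
      rw [add_zero, ← this]; ring_nf
    · have := odd (j + κ) j
      rw [add_zero, add_zero, add_right_comm j 1 κ, ← this]; ring_nf
  · obtain ⟨v, hv | hv⟩ : ∃ v, κ = -2 * v ∨ κ = -2 * v - 1 := ⟨-(κ / 2) - κ % 2, by omega⟩
    · convert hf.comp_add (-v) v.natAbs using 2 with q
      rw [← even, hv]; ring_nf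
    · convert hf.min_succ.comp_add (-v - 1) (max (v + 1) (-v)) using 2 with q
      have := odd (q + (-v - 1)) v
      rw [← this, hv]; ring_nf
  · obtain ⟨p, hp | hp⟩ : ∃ p, κ = 2 * p ∨ κ = 2 * p + 1 := ⟨κ / 2, by omega⟩
    · have e : (fun q => D q (-m * q + m * κ)) = fun q => f p + (q - p).natAbs := by
        funext q; rw [← even, hp]; ring_nf
      rw [e]
      exact DyadicConvex.of_convex (fun i => by omega) (fun L i j hL hij => by omega)
    · have e : (fun q => D q (-m * q + m * κ)) =
          fun q => min (f p) (f (p + 1)) + max (q - p - 1 + 1) (-(q - p - 1)) := by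
        funext q; rw [← odd, hp]; ring_nf
      rw [e]
      exact DyadicConvex.of_convex (fun i => by omega) (fun L i j hL hij => by omega)

end Diagonal

end InfConv

theorem infConv_height (e : Crossing) (r : List Crossing) :
    InfConv (fun q => (height r q (e.out * q + e.offset) : ℤ) + 1) e.inn
      (fun x y => (height (e :: r) x y : ℤ)) where
  le x y q := by have := height_cons_le e r x y q; omega
  exists_eq x y := by
    obtain ⟨q, hq⟩ := exists_height_cons_eq e r x y
    exact ⟨q, by omega⟩

/-- The base plane is treated as if it had been entered through its horizontal axis, with the
function `|q|` there. -/
theorem infConv_height_nil :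
    InfConv (fun q => (q.natAbs : ℤ)) 0 fun x y => (height [] x y : ℤ) := by
  simp only [height]
  exact ⟨fun x y q => by omega, fun x y => ⟨0, by simp⟩⟩

/-- Induction on the crossings: the restriction to the exit line of the previous plane, increased by
`1`, is the function that is convolved in the new plane. All three slopes are carried along because
the next crossing may use any of them. -/
theorem balanced_height (st : List Crossing) (m k : ℤ) (hm : m = 0 ∨ m = 1 ∨ m = -1) :
    DyadicConvex fun q => (height st q (m * q + k) : ℤ) := by
  induction st generalizing m k with
  | nil =>
    exact infConv_height_nil.balanced_line_of_slope_zero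
      (DyadicConvex.of_convex (fun i => by omega) (fun L i j hL hij => by omega))
      (fun q => by positivity) m k hm
  | cons e r ih =>
    have hf := (ih e.out e.offset e.out_cases).comp_add 0 1
    simp only [add_zero] at hf
    rcases e.inn_cases with h | h
    · have := infConv_height e r
      rw [h] at this
      exact this.balanced_line_of_slope_zero hf (fun q => by positivity) m k hm
    · refine (infConv_height e r).balanced_line_of_slope_one h hf m k ?_
      rcases h with h | h <;> rw [h] <;> omega

/-! ### Almost convexity -/

/-- The distance of a point to the origin of the base plane. -/
noncomputable def tripleHeight (p : ℤ × ℤ × List Crossing) : ℕ := height p.2.2 p.1 p.2.1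

/-- A path of `n` steps among the points of height at most `N`. -/
inductive SiteChain (N : ℕ) :
    ℕ → ℤ × ℤ × List Crossing → ℤ × ℤ × List Crossing → Prop
  | refl (p : ℤ × ℤ × List Crossing) (hp : tripleHeight p ≤ N) : SiteChain N 0 p p
  | snoc {n : ℕ} {p q r : ℤ × ℤ × List Crossing} (h : SiteChain N n p q) (hs : SiteStep q r)
      (hr : tripleHeight r ≤ N) : SiteChain N (n + 1) p r

namespace SiteChain

variable {N : ℕ}

theorem target_le {n : ℕ} {p q : ℤ × ℤ × List Crossing} (h : SiteChain N n p q) :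
    tripleHeight q ≤ N := by
  cases h <;> assumption

theorem trans {n m : ℕ} {p q r : ℤ × ℤ × List Crossing} (h : SiteChain N n p q)
    (h' : SiteChain N m q r) : SiteChain N (n + m) p r := by
  induction h' with
  | refl p hp => exact h
  | snoc _ hs hr ih => exact (ih h).snoc hs hr

theorem single {p q : ℤ × ℤ × List Crossing} (hp : tripleHeight p ≤ N) (hs : SiteStep p q)
    (hq : tripleHeight q ≤ N) : SiteChain N 1 p q := (refl p hp).snoc hs hq

theorem symm {n : ℕ} {p q : ℤ × ℤ × List Crossing} (h : SiteChain N n p q) :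
    SiteChain N n q p := by
  induction h with
  | refl p hp => exact refl p hp
  | snoc h hs hr ih =>
    have := (single hr hs.symm h.target_le).trans ih
    rwa [add_comm] at this

theorem mono {n m : ℕ} (hnm : n ≤ m) {p q : ℤ × ℤ × List Crossing} (h : SiteChain N n p q) :
    SiteChain N m p q := by
  induction m, hnm using Nat.le_induction with
  | base => exact h
  | succ m _ ih => exact ih.snoc (.plane _ _ _ _ _ (by simp) (by simp)) h.target_le

end SiteChain

theorem SiteStep.siteElt_eq {p q : ℤ × ℤ × List Crossing} (h : SiteStep p q) :
    siteElt q = siteElt p ∨ ∃ l, siteElt q = siteElt p * gersVal [l] := by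
  cases h with
  | plane x y x' y' st hx hy =>
    by_cases h0 : x' - x = 0 ∧ y' - y = 0
    · left
      rw [show x' = x by omega, show y' = y by omega]
    · obtain ⟨l, hl⟩ := exists_letter_plane _ _ hx hy h0
      exact .inr ⟨l, by rw [hl, ← siteElt_plane, add_sub_cancel, add_sub_cancel]⟩
  | enter x e r =>
    obtain ⟨l, hl⟩ := exists_letter_cross e.sgn e.up
    exact .inr ⟨l, by rw [hl, siteElt_enter]⟩
  | leave x e r =>
    obtain ⟨l, hl⟩ := exists_letter_cross e.sgn (!e.up)
    exact .inr ⟨l, by rw [hl, siteElt_enter, mul_assoc, crossLetter_mul_not, mul_one]⟩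

/-- Only an inequality is needed, and it holds for every stack, reduced or not; so chains of points
need not keep their stacks reduced. -/
theorem siteHeight_siteElt_le (p : ℤ × ℤ × List Crossing) :
    siteHeight (siteElt p) ≤ tripleHeight p := by
  obtain ⟨w, hw, hl⟩ := exists_word_height p.2.2 p.1 p.2.1
  rw [← wordDist_one_le_iff, wordDist_le_iff]
  exact ⟨w, by rw [one_mul]; exact hw, hl⟩

theorem SiteChain.exists_word {N n : ℕ} {p q : ℤ × ℤ × List Crossing} (h : SiteChain N n p q) :
    ∃ w : List (GerstenGen × Bool), siteElt p * gersVal w = siteElt q ∧ w.length ≤ n ∧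
      ∀ t, siteHeight (siteElt p * gersVal (w.take t)) ≤ N := by
  induction h with
  | refl p hp =>
    refine ⟨[], by simp [gersVal, wordVal_nil], le_rfl, fun t => ?_⟩
    simpa [gersVal, wordVal_nil] using (siteHeight_siteElt_le p).trans hp
  | @snoc n p q r h hs hr ih =>
    obtain ⟨w, hw, hl, ht⟩ := ih
    rcases hs.siteElt_eq with he | ⟨l, he⟩
    · exact ⟨w, by rw [hw, he], by omega, ht⟩
    · refine ⟨w ++ [l], ?_, by simpa using hl, fun t => ?_⟩
      · rw [gersVal, wordVal_append, ← mul_assoc, ← gersVal, hw, he]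
      · rcases le_or_gt t w.length with h1 | h1
        · rw [List.take_append_of_le_length h1]; exact ht t
        · rw [List.take_of_length_le (by simpa using h1), gersVal, wordVal_append, ← mul_assoc,
            ← gersVal, hw, ← gersVal, ← he]
          exact (siteHeight_siteElt_le r).trans hr

theorem SiteChain.line {N : ℕ} (st : List Crossing) (x y u v : ℤ) (hu : u.natAbs ≤ 1)
    (hv : v.natAbs ≤ 1) (n : ℕ)
    (h : ∀ j : ℕ, j ≤ n → height st (x + j * u) (y + j * v) ≤ N) :
    SiteChain N n (x, y, st) (x + n * u, y + n * v, st) := by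
  induction n with
  | zero =>
    simp only [Nat.cast_zero, zero_mul, add_zero]
    exact .refl _ (by simpa [tripleHeight] using h 0 le_rfl)
  | succ n ih =>
    refine (ih fun j hj => h j (by omega)).snoc (.plane _ _ _ _ _ ?_ ?_) (h (n + 1) le_rfl)
    · push_cast; ring_nf; exact hu
    · push_cast; ring_nf; exact hv

/-- Points of a ball that lie on a segment whose distance function has no local maximum. -/
theorem SiteChain.segment {N : ℕ} (st : List Crossing) (x y u v : ℤ) (hu : u.natAbs ≤ 1)
    (hv : v.natAbs ≤ 1) (d : ℤ) (n : ℕ) (hd : d.natAbs ≤ n)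
    (h : ∀ j : ℤ, min 0 d ≤ j → j ≤ max 0 d → height st (x + j * u) (y + j * v) ≤ N) :
    SiteChain N n (x, y, st) (x + d * u, y + d * v, st) := by
  refine SiteChain.mono hd ?_
  rcases le_total 0 d with h0 | h0
  · lift d to ℕ using h0
    rw [Int.natAbs_natCast]
    exact SiteChain.line st x y u v hu hv d fun j hj => h j (by omega) (by omega)
  · obtain ⟨d, rfl⟩ : ∃ d' : ℕ, d = -d' := ⟨d.natAbs, by omega⟩
    have := SiteChain.line (N := N) st x y (-u) (-v) (by simpa) (by simpa) d fun j hj => by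
      have := h (-j) (by omega) (by omega)
      simpa using this
    simpa using this

/-- The height does not decrease with the distance from the entry line. Hence the row of the
endpoint nearer to that line can be followed first, where both ends are in the ball and
quasiconvexity controls the interior, and then the column. -/
theorem SiteChain.plane_of_slope_zero {N : ℕ} {st : List Crossing} {f : ℤ → ℤ}
    (hD : InfConv f 0 fun x y => (height st x y : ℤ)) {x y x' y' : ℤ}
    (hx : (x' - x).natAbs ≤ 2) (hy : (y' - y).natAbs ≤ 2) (h : height st x y ≤ N)
    (h' : height st x' y' ≤ N) : SiteChain N 4 (x, y, st) (x', y', st) := by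
  have key : ∀ x y x' y' : ℤ, (x' - x).natAbs ≤ 2 → (y' - y).natAbs ≤ 2 → height st x y ≤ N →
      height st x' y' ≤ N → y.natAbs ≤ y'.natAbs → SiteChain N 4 (x, y, st) (x', y', st) := by
    intro x y x' y' hx hy h h' hyy
    have row := balanced_height st 0 y (.inl rfl)
    simp only [zero_mul, zero_add] at row
    have mono : ∀ z : ℤ, z.natAbs ≤ y'.natAbs → height st x' z ≤ N := fun z hz => by
      have := hD.mono_right x' hz
      omega
    have c1 := SiteChain.segment (N := N) st x y 1 0 (by simp) (by simp) (x' - x) 2 (by omega)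
      fun j hj1 hj2 => by
        have h1 := row.le_max (i := min x x') (j := max x x') (l := x + j) (by omega) (by omega)
        have := mono y hyy
        rw [mul_one, mul_zero, add_zero]
        rcases le_total x x' with h0 | h0 <;> simp only [h0, inf_of_le_left, inf_of_le_right,
          sup_of_le_left, sup_of_le_right] at h1 <;> omega
    have c2 := SiteChain.segment (N := N) st x' y 0 1 (by simp) (by simp) (y' - y) 2 (by omega)
      fun j hj1 hj2 => by
        have := mono (y + j) (by omega)
        simpa using this
    simp only [mul_one, mul_zero, add_zero, add_sub_cancel] at c1 c2
    exact c1.trans c2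
  rcases le_total y.natAbs y'.natAbs with h0 | h0
  · exact key x y x' y' hx hy h h' h0
  · exact (key x' y' x y (by omega) (by omega) h' h h0).symm

/-- The same route in the coordinates `p` along the entry line and `v` across it, where the height
is `f p + |v|`. These coordinates exist for one parity only, so each endpoint is first moved by at
most one step. -/
theorem SiteChain.plane_of_slope_one {N : ℕ} {st : List Crossing} {f : ℤ → ℤ} {m : ℤ}
    (hf : DyadicConvex f) (hm : m = 1 ∨ m = -1)
    (hD : InfConv f m fun x y => (height st x y : ℤ)) {x y x' y' : ℤ}
    (hx : (x' - x).natAbs ≤ 2) (hy : (y' - y).natAbs ≤ 2) (h : height st x y ≤ N)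
    (h' : height st x' y' ≤ N) : SiteChain N 10 (x, y, st) (x', y', st) := by
  have hmm : m * m = 1 := by rcases hm with rfl | rfl <;> rfl
  have even := hD.apply_even hm hf
  have odd := hD.apply_odd hm hf
  have reach : ∀ x y : ℤ, height st x y ≤ N → ∃ p v : ℤ,
      SiteChain N 1 (x, y, st) (p + v, m * (p - v), st) ∧
      (p + v - x).natAbs ≤ 1 ∧ (m * (p - v) - y).natAbs ≤ 1 := by
    intro x y h
    obtain ⟨η, rfl⟩ : ∃ η, y = m * η := ⟨m * y, by rw [← mul_assoc, hmm, one_mul]⟩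
    have near : ∀ p v : ℤ, (p + v - x).natAbs ≤ 1 → (p - v - η).natAbs ≤ 1 →
        height st (p + v) (m * (p - v)) ≤ N → ∃ p v : ℤ,
        SiteChain N 1 (x, m * η, st) (p + v, m * (p - v), st) ∧
        (p + v - x).natAbs ≤ 1 ∧ (m * (p - v) - m * η).natAbs ≤ 1 := by
      intro p v h1 h2 h3
      have h4 : (m * (p - v) - m * η).natAbs ≤ 1 := by rcases hm with rfl | rfl <;> omega
      exact ⟨p, v, .single h (.plane _ _ _ _ _ h1 h4) h3, h1, h4⟩
    rcases Int.emod_two_eq_zero_or_one (x + η) with h0 | h0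
    · refine near ((x + η) / 2) ((x - η) / 2) (by omega) (by omega) ?_
      rw [show (x + η) / 2 + (x - η) / 2 = x by omega,
        show (x + η) / 2 - (x - η) / 2 = η by omega]
      exact h
    · obtain ⟨p, v, rfl, rfl⟩ : ∃ p v, x = p + v + 1 ∧ η = p - v :=
        ⟨(x + η) / 2, (x - η) / 2, by omega, by omega⟩
      -- The height of an odd point involves the smaller of two values of `f`; the even neighbour
      -- over that foot is no higher.
      have h1 := odd p v
      rcases le_total (f p) (f (p + 1)) with hle | hle
      · refine near p v (by omega) (by omega) ?_
        have := even p v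
        omega
      · refine near (p + 1) v (by omega) (by omega) ?_
        have := even (p + 1) v
        omega
  have key : ∀ p v p' v' : ℤ, (p' - p).natAbs ≤ 4 → (v' - v).natAbs ≤ 4 →
      height st (p + v) (m * (p - v)) ≤ N → height st (p' + v') (m * (p' - v')) ≤ N →
      v.natAbs ≤ v'.natAbs →
      SiteChain N 8 (p + v, m * (p - v), st) (p' + v', m * (p' - v'), st) := by
    intro p v p' v' hp hv h h' hvv
    have e1 := even p v
    have e2 := even p' v'
    have habs : m.natAbs ≤ 1 := by rcases hm with rfl | rfl <;> simp
    have c1 := SiteChain.segment (N := N) st (p + v) (m * (p - v)) 1 m (by simp) habs (p' - p) 4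
      hp fun j hj1 hj2 => by
        have e3 := even (p + j) v
        rw [show p + v + j * 1 = p + j + v by ring,
          show m * (p - v) + j * m = m * (p + j - v) by ring]
        have h1 := hf.le_max (i := min p p') (j := max p p') (l := p + j) (by omega) (by omega)
        rcases le_total p p' with h0 | h0 <;> simp only [h0, inf_of_le_left, inf_of_le_right,
          sup_of_le_left, sup_of_le_right] at h1 <;> omega
    have c2 := SiteChain.segment (N := N) st (p' + v) (m * (p' - v)) 1 (-m) (by simp)
      (by simpa using habs) (v' - v) 4 hv fun j hj1 hj2 => by
        have e3 := even p' (v + j)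
        rw [show p' + v + j * 1 = p' + (v + j) by ring,
          show m * (p' - v) + j * -m = m * (p' - (v + j)) by ring]
        omega
    rw [show p + v + (p' - p) * 1 = p' + v by ring,
      show m * (p - v) + (p' - p) * m = m * (p' - v) by ring] at c1
    rw [show p' + v + (v' - v) * 1 = p' + v' by ring,
      show m * (p' - v) + (v' - v) * -m = m * (p' - v') by ring] at c2
    exact c1.trans c2
  obtain ⟨p, v, c1, h1, h2⟩ := reach x y h
  obtain ⟨p', v', c2, h1', h2'⟩ := reach x' y' h'
  -- The original points differ by at most `2` in each coordinate and each was moved by at most `1`.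
  -- So `p + v` and `p - v` change by at most `4`, and so do `p` and `v`; the total length is `1 +
  -- (4 + 4) + 1`.
  have hp : (p' - p).natAbs ≤ 4 ∧ (v' - v).natAbs ≤ 4 := by
    have bd : ∀ (z : ℤ) (n : ℕ), z.natAbs ≤ n → -n ≤ z ∧ z ≤ n := by omega
    have b1 := bd _ _ h1
    have b2 := bd _ _ h2
    have b3 := bd _ _ h1'
    have b4 := bd _ _ h2'
    have b5 := bd _ _ hx
    have b6 := bd _ _ hy
    clear h1 h2 h1' h2' hx hy
    push_cast at *
    rcases hm with rfl | rfl <;> constructor <;> omega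
  have c : SiteChain N 8 (p + v, m * (p - v), st) (p' + v', m * (p' - v'), st) := by
    rcases le_total v.natAbs v'.natAbs with h0 | h0
    · exact key p v p' v' hp.1 hp.2 c1.target_le c2.target_le h0
    · exact (key p' v' p v (by omega) (by omega) c2.target_le c1.target_le h0).symm
  exact (c1.trans c).trans c2.symm

theorem SiteChain.plane {N : ℕ} {st : List Crossing} {x y x' y' : ℤ}
    (hx : (x' - x).natAbs ≤ 2) (hy : (y' - y).natAbs ≤ 2) (h : height st x y ≤ N)
    (h' : height st x' y' ≤ N) : SiteChain N 10 (x, y, st) (x', y', st) := by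
  cases st with
  | nil => exact (SiteChain.plane_of_slope_zero infConv_height_nil hx hy h h').mono (by norm_num)
  | cons e r =>
    have hD := infConv_height e r
    rcases e.inn_cases with h0 | h0
    · rw [h0] at hD
      exact (SiteChain.plane_of_slope_zero hD hx hy h h').mono (by norm_num)
    · have hf := (balanced_height r e.out e.offset e.out_cases).comp_add 0 1
      simp only [add_zero] at hf
      exact SiteChain.plane_of_slope_one hf h0 hD hx hy h h'

theorem SiteStep.cases_eq {p q : ℤ × ℤ × List Crossing} (h : SiteStep p q) :
    (∃ x y x' y' st, p = (x, y, st) ∧ q = (x', y', st) ∧ (x' - x).natAbs ≤ 1 ∧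
      (y' - y).natAbs ≤ 1) ∨
    (∃ x e r, p = (x, e.out * x + e.offset, r) ∧ q = (x, e.inn * x, e :: r)) ∨
    (∃ x e r, p = (x, e.inn * x, e :: r) ∧ q = (x, e.out * x + e.offset, r)) := by
  cases h with
  | plane x y x' y' st hx hy => exact .inl ⟨x, y, x', y', st, rfl, rfl, hx, hy⟩
  | enter x e r => exact .inr (.inl ⟨x, e, r, rfl, rfl⟩)
  | leave x e r => exact .inr (.inr ⟨x, e, r, rfl, rfl⟩)

/-- A detour through a point of height `N + 1` from the line through which a plane was entered into
the plane can be avoided. -/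
theorem SiteChain.enter_plane {N : ℕ} {e : Crossing} {r : List Crossing} {x x' y' : ℤ}
    (h : height r x (e.out * x + e.offset) = N) (hx : (x' - x).natAbs ≤ 1)
    (hy : (y' - e.inn * x).natAbs ≤ 1) (h' : height (e :: r) x' y' = N) :
    SiteChain N 12 (x, e.out * x + e.offset, r) (x', y', e :: r) := by
  obtain ⟨q, hq⟩ := exists_height_cons_eq e r x' y'
  have hf := (balanced_height r e.out e.offset e.out_cases).lipschitz
  have hq' : height r q (e.out * q + e.offset) + 1 + (x' - q).natAbs ≤ N := by
    rw [← h', hq]; exact Nat.add_le_add_left (le_max_left _ _) _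
  -- Crossing at `x` itself would give the target height at least `N + 1`.
  have hqx : q ≠ x := by rintro rfl; omega
  -- One step along the line towards the optimal crossing point `q` of the target lowers the height
  -- enough to cross inside the ball.
  obtain ⟨u, hu, hu'⟩ : ∃ u : ℤ, u.natAbs ≤ 1 ∧ (q - (x + u)).natAbs + 1 = (q - x).natAbs := by
    clear * - hqx
    rcases lt_or_gt_of_ne hqx with h0 | h0
    · exact ⟨-1, by omega, by omega⟩
    · exact ⟨1, by omega, by omega⟩
  have hN : height r (x + u) (e.out * (x + u) + e.offset) + 1 ≤ N := by
    have hl := hf q (x + u)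
    clear * - hl hq' hu' hx
    omega
  have ho : (e.out * u).natAbs ≤ 1 := by
    clear * - hu
    rcases e.out_cases with h | h | h <;> rw [h] <;> omega
  have hi : (e.inn * u).natAbs ≤ 1 := by
    clear * - hu
    rcases e.inn_cases with h | h | h <;> rw [h] <;> omega
  have ex : e.out * (x + u) + e.offset = e.out * x + e.offset + e.out * u := by ring
  have ei : e.inn * (x + u) = e.inn * x + e.inn * u := by ring
  have c1 : SiteChain N 1 (x, e.out * x + e.offset, r)
      (x + u, e.out * (x + u) + e.offset, r) :=
    .single h.le (.plane _ _ _ _ _ (by clear * - hu; omega) (by clear * - ho ex; omega))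
      (by simp only [tripleHeight]; clear * - hN; omega)
  have c2 : SiteChain N 1 (x + u, e.out * (x + u) + e.offset, r)
      (x + u, e.inn * (x + u), e :: r) :=
    .single c1.target_le (.enter _ _ _) (by simp only [tripleHeight, height_line]; exact hN)
  have c3 : SiteChain N 10 (x + u, e.inn * (x + u), e :: r) (x', y', e :: r) :=
    SiteChain.plane (by clear * - hx hu; omega) (by clear * - ei hy hi; omega) c2.target_le h'.le
  exact (c1.trans c2).trans c3

/-- Only paths of two edges whose middle point has height `N + 1` matter. Two edges in one plane, or
a crossing combined with an edge of the entered plane, are replaced by detours; the other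
combinations contradict the heights or return to the same point. The constant is `1 + 1 + 10`. -/
theorem almostConvex_gersten : AlmostConvex (presentedGens gerstenRels) := by
  have key : ∀ (N : ℕ) (g h : GerstenGroup), siteHeight g ≤ N → siteHeight h ≤ N →
      ∀ w : List (GerstenGen × Bool), g * gersVal w = h → w.length ≤ 2 →
      SiteChain N 12 (site g).1 (site h).1 := by
    rintro N g h hg hh w rfl hw
    rcases w with _ | ⟨l, _ | ⟨l', _ | ⟨l'', w⟩⟩⟩
    · rw [gersVal, wordVal_nil, mul_one]
      exact (SiteChain.refl _ hg).mono (by norm_num)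
    · exact (SiteChain.single hg (siteStep_letter g l) hh).mono (by norm_num)
    · have s1 := siteStep_letter g l
      have s2 := siteStep_letter (g * gersVal [l]) l'
      rw [mul_assoc, ← wordVal_cons] at s2
      change tripleHeight (site g).1 ≤ N at hg
      change tripleHeight (site (g * gersVal [l, l'])).1 ≤ N at hh
      generalize (site g).1 = p at *
      generalize (site (g * gersVal [l, l'])).1 = q at *
      generalize (site (g * gersVal [l])).1 = m at *
      by_cases hm : tripleHeight m ≤ N
      · exact ((SiteChain.single hg s1 hm).snoc s2 hh).mono (by norm_num)
      have b1 := s1.height_le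
      have b2 := s2.symm.height_le
      change tripleHeight m ≤ tripleHeight p + 1 at b1
      change tripleHeight m ≤ tripleHeight q + 1 at b2
      rcases s1.cases_eq with ⟨x, y, x', y', st, rfl, rfl, hx, hy⟩ | ⟨x, e, r, rfl, rfl⟩ |
        ⟨x, e, r, rfl, rfl⟩
      · rcases s2.cases_eq with ⟨x1, y1, x2, y2, st', h1, rfl, hx', hy'⟩ | ⟨x1, e, r, h1, rfl⟩ |
          ⟨x1, e, r, h1, rfl⟩
        · simp only [Prod.mk.injEq] at h1
          obtain ⟨rfl, rfl, rfl⟩ := h1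
          exact (SiteChain.plane (x := x) (y := y) (x' := x2) (y' := y2) (by omega) (by omega)
            hg hh).mono (by norm_num)
        -- Entering a further plane raises the height by one, so the endpoint would have height `N +
        -- 2`.
        · exfalso
          rw [h1] at hm
          simp only [tripleHeight, height_line] at hm hh
          omega
        · simp only [Prod.mk.injEq] at h1
          obtain ⟨rfl, rfl, rfl⟩ := h1
          simp only [tripleHeight] at *
          exact (SiteChain.enter_plane (by omega) (by omega) (by omega) (by omega)).symm
      · rcases s2.cases_eq with ⟨x1, y1, x2, y2, st', h1, rfl, hx', hy'⟩ | ⟨x1, e', r', h1, rfl⟩ |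
          ⟨x1, e', r', h1, rfl⟩
        · simp only [Prod.mk.injEq] at h1
          obtain ⟨rfl, rfl, rfl⟩ := h1
          simp only [tripleHeight] at *
          exact SiteChain.enter_plane (by omega) hx' hy' (by omega)
        · exfalso
          rw [h1] at hm
          simp only [tripleHeight, height_line] at hm hh
          omega
        · simp only [Prod.mk.injEq, List.cons.injEq] at h1
          obtain ⟨rfl, -, rfl, rfl⟩ := h1
          exact (SiteChain.refl _ hg).mono (by norm_num)
      -- Leaving a plane towards the base lowers the height, so the middle point would lie in the
      -- ball.
      · exfalso
        simp only [tripleHeight, height_line] at hm hg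
        omega
    · simp only [List.length_cons] at hw; omega
  refine ⟨12, fun N g h hg hh hgh => ?_⟩
  rw [wordDist_one_le_iff] at hg hh
  obtain ⟨w, hw, hl⟩ := (wordDist_le_iff _ _ _ 2).1 hgh
  obtain ⟨w', hw', hl', ht⟩ := (key N g h hg hh w hw hl).exists_word
  rw [siteElt_site, siteElt_site] at hw'
  rw [siteElt_site] at ht
  exact ⟨w', hw', hl', fun t => (wordDist_one_le_iff _ _).2 (ht t)⟩

/-! ### Failure of the loop shortening property -/

/-- The point reached after `t` steps of a path. -/
def sitePath (g : GerstenGroup) (w : List (GerstenGen × Bool)) (t : ℕ) :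
    ℤ × ℤ × List Crossing := (site (pathPoint (presentedGens gerstenRels) g w t)).1

theorem pathPoint_add {G ι : Type*} [Group G] (x : ι → G) (g : G) (w : List (ι × Bool))
    (s n : ℕ) : pathPoint x g w (s + n) = pathPoint x g w s * wordVal x ((w.drop s).take n) := by
  rw [pathPoint, pathPoint, List.take_add, wordVal_append, mul_assoc]

theorem sitePath_step (g : GerstenGroup) (w : List (GerstenGen × Bool)) (t : ℕ) :
    SiteStep (sitePath g w t) (sitePath g w (t + 1)) := by
  rw [sitePath, sitePath, pathPoint_add]
  rcases h : w.drop t with _ | ⟨l, w'⟩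
  · simp only [List.take_nil, wordVal_nil, mul_one]
    exact .plane _ _ _ _ _ (by simp) (by simp)
  · simpa using siteStep_letter _ l

theorem sitePath_isometric {g : GerstenGroup} {w : List (GerstenGen × Bool)} {s t : ℕ}
    (hst : s ≤ t) {x y x' y' : ℤ} {st : List Crossing} (h : sitePath g w s = (x, y, st))
    (h' : sitePath g w t = (x', y', st)) : max (x' - x).natAbs (y' - y).natAbs ≤ t - s := by
  obtain ⟨n, rfl⟩ := Nat.exists_eq_add_of_le hst
  rw [sitePath, pathPoint_add] at h'
  have := plane_isometric h h'
  simp only [List.length_take] at this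
  omega

/-- The point lies beyond the line of the base plane given by `e`. -/
def InBranch (e : Crossing) (p : ℤ × ℤ × List Crossing) : Prop := [e] <:+ p.2.2

theorem InBranch.unique {e e' : Crossing} {p : ℤ × ℤ × List Crossing} (h : InBranch e p)
    (h' : InBranch e' p) : e = e' := by
  have := List.suffix_of_suffix_length_le h h' (by simp)
  simpa using this.eq_of_length (by simp)

/-- The bottom entry of a stack can be removed only when it is the whole stack, that is, on the
boundary line in the base plane. -/
theorem SiteStep.leave_branch {e : Crossing} {p q : ℤ × ℤ × List Crossing} (h : SiteStep p q)
    (hp : InBranch e p) (hq : ¬ InBranch e q) :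
    ∃ x, p = (x, e.inn * x, [e]) ∧ q = (x, e.out * x + e.offset, []) := by
  cases h with
  | plane x y x' y' st hx hy => exact absurd hp hq
  | enter x e' r => exact absurd (hp.trans (List.suffix_cons _ _)) hq
  | leave x e' r =>
    rcases List.suffix_cons_iff.1 hp with h | h
    · simp only [List.cons.injEq] at h
      obtain ⟨rfl, rfl⟩ := h
      exact ⟨x, rfl, rfl⟩
    · exact absurd h hq

theorem exists_leave_branch {e : Crossing} {P : ℕ → ℤ × ℤ × List Crossing}
    (hP : ∀ t, SiteStep (P t) (P (t + 1))) {s t : ℕ} (hst : s ≤ t) (hs : InBranch e (P s))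
    (ht : ¬ InBranch e (P t)) : ∃ τ x, s ≤ τ ∧ τ < t ∧ P τ = (x, e.inn * x, [e]) ∧
      P (τ + 1) = (x, e.out * x + e.offset, []) := by
  induction t, hst using Nat.le_induction with
  | base => exact absurd hs ht
  | succ t hst ih =>
    by_cases h : InBranch e (P t)
    · obtain ⟨x, h1, h2⟩ := (hP t).leave_branch h ht
      exact ⟨t, x, hst, by omega, h1, h2⟩
    · obtain ⟨τ, x, h1, h2, h3⟩ := ih h
      exact ⟨τ, x, h1, by omega, h3⟩

theorem exists_enter_branch {e : Crossing} {P : ℕ → ℤ × ℤ × List Crossing}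
    (hP : ∀ t, SiteStep (P t) (P (t + 1))) {s t : ℕ} (hst : s ≤ t) (hs : ¬ InBranch e (P s))
    (ht : InBranch e (P t)) : ∃ τ x, s ≤ τ ∧ τ < t ∧
      P τ = (x, e.out * x + e.offset, []) ∧ P (τ + 1) = (x, e.inn * x, [e]) := by
  induction t, hst using Nat.le_induction with
  | base => exact absurd ht hs
  | succ t hst ih =>
    by_cases h : InBranch e (P t)
    · obtain ⟨τ, x, h1, h2, h3⟩ := ih h
      exact ⟨τ, x, h1, by omega, h3⟩
    · obtain ⟨x, h1, h2⟩ := (hP t).symm.leave_branch ht h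
      exact ⟨t, x, hst, by omega, h2, h1⟩

/-- A path from a branch to another one crosses both boundary lines. -/
theorem exists_leave_enter {e e' : Crossing} (he : e ≠ e') {P : ℕ → ℤ × ℤ × List Crossing}
    (hP : ∀ t, SiteStep (P t) (P (t + 1))) {s t : ℕ} (hst : s ≤ t) (hs : InBranch e (P s))
    (ht : InBranch e' (P t)) : ∃ τ x σ x', s ≤ τ ∧ τ + 1 ≤ σ ∧ σ < t ∧
      P τ = (x, e.inn * x, [e]) ∧ P (τ + 1) = (x, e.out * x + e.offset, []) ∧
      P σ = (x', e'.out * x' + e'.offset, []) ∧ P (σ + 1) = (x', e'.inn * x', [e']) := by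
  obtain ⟨τ, x, h1, h2, h3, h4⟩ := exists_leave_branch hP hst hs fun h => he (h.unique ht)
  obtain ⟨σ, x', h5, h6, h7, h8⟩ := exists_enter_branch (e := e') hP (s := τ + 1) h2
    (by rw [h4]; simp [InBranch]) ht
  exact ⟨τ, x, σ, x', h1, h5, h6, h3, h4, h7, h8⟩

/-- A point at height `m` over the boundary line of a branch stays in the branch when it is moved
by less than `m`. -/
theorem inBranch_of_wordDist_le {e : Crossing} {k m : ℕ} (hkm : k < m) {g h : GerstenGroup}
    {x y : ℤ} (he : e.inn = 0) (hg : (site g).1 = (x, y, [e])) (hy : y.natAbs = m)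
    (hgh : wordDist (presentedGens gerstenRels) g h ≤ k) : InBranch e (site h).1 := by
  obtain ⟨w, rfl, hl⟩ := (wordDist_le_iff _ _ _ _).1 hgh
  by_contra hb
  have h0 : sitePath g w 0 = (x, y, [e]) := by simp [sitePath, pathPoint, wordVal_nil, hg]
  -- An exit from the branch passes through a point of ordinate `0` of the same plane, at distance
  -- at least `m` from the start.
  obtain ⟨τ, x', -, h2, h3, -⟩ := exists_leave_branch (sitePath_step g w) (Nat.zero_le w.length)
    (by rw [h0]; exact List.suffix_refl _)
    (by simpa [sitePath, pathPoint] using hb)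
  have := sitePath_isometric (Nat.zero_le τ) h0 h3
  rw [he] at this
  omega

/-- A closed path that visits the four branches at the sides of a rhombus in cyclic order is at
least as long as the boundary of the rhombus, with the four lines crossed twice each. -/
theorem length_ge_of_visits {m : ℕ} {h : GerstenGroup}
    {u : List (GerstenGen × Bool)}
    (hu : h * gersVal u = h) {t₂ t₃ t₄ : ℕ} (h23 : t₂ ≤ t₃) (h34 : t₃ ≤ t₄)
    (h1 : InBranch ⟨true, false, 0⟩ (sitePath h u 0))
    (h2 : InBranch ⟨false, false, 4 * m⟩ (sitePath h u t₂))
    (h3 : InBranch ⟨true, false, 4 * m⟩ (sitePath h u t₃))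
    (h4 : InBranch ⟨false, false, 0⟩ (sitePath h u t₄)) : 8 * m + 8 ≤ u.length := by
  have hend : ∀ t, sitePath h u (min t u.length) = sitePath h u t := by
    intro t
    simp only [sitePath, pathPoint]
    rcases le_total t u.length with h | h
    · rw [min_eq_left h]
    · rw [min_eq_right h, List.take_length, List.take_of_length_le h]
  have hT : sitePath h u u.length = sitePath h u 0 := by
    simp [sitePath, pathPoint, wordVal_nil, hu]
  -- Times after the end of the path are replaced by its length, so that all visits lie in one
  -- period.
  rw [← hend] at h2 h3 h4
  have hP := sitePath_step h u
  obtain ⟨τ₁, x₁', σ₂, x₂, a1, a2, a3, a4, a5, a6, a7⟩ :=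
    exists_leave_enter (by simp) hP (Nat.zero_le _) h1 h2
  obtain ⟨τ₂, x₂', σ₃, x₃, b1, b2, b3, b4, b5, b6, b7⟩ :=
    exists_leave_enter (by simp) hP (by omega) h2 h3
  obtain ⟨τ₃, x₃', σ₄, x₄, c1, c2, c3, c4, c5, c6, c7⟩ :=
    exists_leave_enter (by simp) hP (by omega) h3 h4
  obtain ⟨τ₄, x₄', σ₁, x₁, d1, d2, d3, d4, d5, d6, d7⟩ :=
    exists_leave_enter (by simp) hP (min_le_right _ _) h4 (hT ▸ h1)
  have e1 := sitePath_isometric a2 a5 a6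
  have e2 := sitePath_isometric (by omega) a7 b4
  have e3 := sitePath_isometric b2 b5 b6
  have e4 := sitePath_isometric (by omega) b7 c4
  have e5 := sitePath_isometric c2 c5 c6
  have e6 := sitePath_isometric (by omega) c7 d4
  have e7 := sitePath_isometric d2 d5 d6
  -- The last stay in the first branch runs through the base point of the loop, so it is measured
  -- along the end of `u` followed by its beginning.
  have e8 : (x₁' - x₁).natAbs ≤ u.length - (σ₁ + 1) + τ₁ := by
    have hw : pathPoint (presentedGens gerstenRels) h u τ₁ =
        pathPoint (presentedGens gerstenRels) h u (σ₁ + 1) *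
          gersVal (u.drop (σ₁ + 1) ++ u.take τ₁) := by
      rw [gersVal, wordVal_append, ← mul_assoc, pathPoint, pathPoint, mul_assoc h,
        ← wordVal_append, List.take_append_drop]
      exact congrArg (· * _) hu.symm
    rw [sitePath, hw] at a4
    have := plane_isometric d7 a4
    simp only [List.length_append, List.length_drop, List.length_take] at this
    omega
  simp only [Crossing.out, Crossing.inn, exitSlope, stableSign, Bool.not_false, if_true,
    Bool.false_eq_true, if_false] at e1 e2 e3 e4 e5 e6 e7
  have lft : ∀ {a b n : ℕ}, max a b ≤ n → a ≤ n := fun h => (le_max_left _ _).trans h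
  have rgt : ∀ {a b n : ℕ}, max a b ≤ n → b ≤ n := fun h => (le_max_right _ _).trans h
  -- The ordinate is used for the first and third passages through the base plane, the abscissa for
  -- the other two and for the four branches. With suitable signs the eight displacements telescope
  -- to `8 * m`; the eight crossings, one unit of time each, give the remaining `8`.
  have f1 := rgt e1
  have f2 := lft e2
  have f3 := lft e3
  have f4 := lft e4
  have f5 := rgt e5
  have f6 := lft e6
  have f7 := lft e7
  have ab : ∀ {z : ℤ} {n : ℕ}, z.natAbs ≤ n → z ≤ n ∧ -z ≤ n := by omega
  have g1 := ab f1
  have g2 := ab f2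
  have g3 := ab f3
  have g4 := ab f4
  have g5 := ab f5
  have g6 := ab f6
  have g7 := ab f7
  have g8 := ab e8
  clear e1 e2 e3 e4 e5 e6 e7 e8 f1 f2 f3 f4 f5 f6 f7 lft rgt ab
  omega

/-! ### The loop around the rhombus -/

theorem site_mul_crossLetter (g : GerstenGroup) (σ up : Bool) :
    (site (g * crossLetter σ up)).1 = crossRaw σ up (site g).1 := by
  rw [site_mul]
  cases σ <;> cases up <;>
    simp only [crossLetter, stableLetter, Bool.false_eq_true, if_false, if_true, map_inv,
      siteHom_gen, inv_inv] <;> rfl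

theorem site_mul_planeElt_eq {g : GerstenGroup} {x y : ℤ} {st : List Crossing}
    (h : (site g).1 = (x, y, st)) (u v : ℤ) :
    (site (g * planeElt u v)).1 = (x + u, y + v, st) := by
  rw [site_mul_planeElt]; simp [shift, h]

/-- The word that goes down to the boundary line of a branch, crosses the base plane at a corner of
the rhombus, and goes up in the next branch. -/
def cornerWord (m : ℕ) (l : GerstenGen × Bool) (σ : Bool) (l' : GerstenGen × Bool) :
    List (GerstenGen × Bool) :=
  List.replicate m l ++ [(if σ then .s else .t, true), (if σ then .t else .s, false)] ++
    List.replicate m l'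

theorem length_cornerWord (m : ℕ) (l : GerstenGen × Bool) (σ : Bool) (l' : GerstenGen × Bool) :
    (cornerWord m l σ l').length = 2 * m + 2 := by
  simp [cornerWord]; ring

theorem gersVal_replicate {l : GerstenGen × Bool} {u v : ℤ} (hl : gersVal [l] = planeElt u v)
    (m : ℕ) : gersVal (List.replicate m l) = planeElt (m * u) (m * v) := by
  induction m with
  | zero => simp [gersVal, wordVal_nil, planeElt_zero]
  | succ m ih =>
    rw [List.replicate_succ, gersVal, wordVal_cons, ← gersVal, ← gersVal, ih, hl, planeElt_mul]
    push_cast; ring_nf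

/-- The base plane is met at one point `(X, stableSign σ * X + k)`. The next line passes through it
with the opposite slope, which gives the new offset. -/
theorem site_cornerWord {g : GerstenGroup} {x y : ℤ} {σ : Bool} {k : ℤ} (m : ℕ)
    {l l' : GerstenGen × Bool} {u v u' v' : ℤ} (hl : gersVal [l] = planeElt u v)
    (hl' : gersVal [l'] = planeElt u' v')
    (h : (site g).1 = (x, y, [⟨σ, false, k⟩])) (hy : y = -(m * v)) :
    (site (g * gersVal (cornerWord m l σ l'))).1 = (x + m * u + m * u', m * v',
      [⟨!σ, false, k + 2 * (stableSign σ * (x + m * u))⟩]) := by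
  have hmid : gersVal [(if σ then GerstenGen.s else .t, true),
      (if σ then GerstenGen.t else .s, false)] = crossLetter σ true * crossLetter (!σ) false := by
    cases σ <;> simp [gersVal, wordVal, crossLetter, stableLetter]
  have hw : g * gersVal (cornerWord m l σ l') = g * planeElt (m * u) (m * v) *
      crossLetter σ true * crossLetter (!σ) false * planeElt (m * u') (m * v') := by
    rw [cornerWord, gersVal, wordVal_append, wordVal_append, ← gersVal, ← gersVal, ← gersVal,
      gersVal_replicate hl, gersVal_replicate hl', hmid]
    simp only [mul_assoc]
  subst hy
  have s1 := site_mul_planeElt_eq h (m * u) (m * v)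
  have s2 := site_mul_crossLetter (g * planeElt (m * u) (m * v)) σ true
  rw [s1] at s2
  have s3 := site_mul_crossLetter (g * planeElt (m * u) (m * v) * crossLetter σ true) (!σ) false
  rw [s2] at s3
  rw [hw]
  rw [site_mul_planeElt, shift]
  simp only [Equiv.coe_fn_mk, s3]
  cases σ <;> simp [crossRaw, exitSlope, stableSign] <;> ring

theorem not_loopShortening_gersten : ¬ LoopShortening (presentedGens gerstenRels) := by
  rintro ⟨k, -, H⟩
  -- At height `m > k`, a displacement by at most `k` cannot leave the branch.
  obtain ⟨m, hm⟩ : ∃ m, m = k + 1 := ⟨_, rfl⟩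
  obtain ⟨-, -, hc, hd⟩ := gen_eq_planeElt
  have lc : gersVal [(.c, true)] = planeElt 1 1 := by simp [gersVal, wordVal, hc]
  have lc' : gersVal [(.c, false)] = planeElt (-1) (-1) := by
    simp [gersVal, wordVal, hc, planeElt_inv]
  have ld : gersVal [(.d, true)] = planeElt 1 (-1) := by simp [gersVal, wordVal, hd]
  have ld' : gersVal [(.d, false)] = planeElt (-1) 1 := by
    simp [gersVal, wordVal, hd, planeElt_inv]
  set w₁ := cornerWord m (.d, true) true (.c, false) with hw₁
  set w₂ := cornerWord m (.d, false) false (.c, false) with hw₂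
  set w₃ := cornerWord m (.d, false) true (.c, true) with hw₃
  set w₄ := cornerWord m (.d, true) false (.c, true) with hw₄
  -- The loop starts over the middle of the side from `(0, 0)` to `(2m, 2m)`; the other corners are
  -- `(0, 4m)` and `(-2m, 2m)`. Each `cornerWord` leads from over the middle of one side to over the
  -- middle of the next.
  obtain ⟨g, hg⟩ : ∃ g, g = crossLetter true false * planeElt m m := ⟨_, rfl⟩
  have s0 : (site g).1 = ((m : ℤ), (m : ℤ), [⟨true, false, 0⟩]) := by
    have := site_mul_crossLetter 1 true false
    rw [one_mul, site_one] at this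
    rw [hg, site_mul_planeElt, shift]
    simp only [Equiv.coe_fn_mk, this]
    simp [crossRaw, originSite, exitSlope, stableSign]
  have s1 : (site (g * gersVal w₁)).1 = ((m : ℤ), -(m : ℤ), [⟨false, false, 4 * (m : ℤ)⟩]) := by
    rw [hw₁, site_cornerWord m ld lc' s0 (by ring)]
    simp [stableSign]; ring
  have s2 : (site (g * gersVal w₁ * gersVal w₂)).1 = (-(m : ℤ), -(m : ℤ), [⟨true, false, 4 * (m : ℤ)⟩]) := by
    rw [hw₂, site_cornerWord m ld' lc' s1 (by ring)]
    simp [stableSign]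
  have s3 : (site (g * gersVal w₁ * gersVal w₂ * gersVal w₃)).1 =
      (-(m : ℤ), (m : ℤ), [⟨false, false, 0⟩]) := by
    rw [hw₃, site_cornerWord m ld' lc s2 (by ring)]
    simp [stableSign]; ring
  have s4 : (site (g * gersVal w₁ * gersVal w₂ * gersVal w₃ * gersVal w₄)).1 =
      ((m : ℤ), (m : ℤ), [⟨true, false, 0⟩]) := by
    rw [hw₄, site_cornerWord m ld lc s3 (by ring)]
    simp [stableSign]
  set w := w₁ ++ (w₂ ++ (w₃ ++ w₄)) with hw
  have l1 : w₁.length = 2 * m + 2 := length_cornerWord _ _ _ _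
  have l2 : w₂.length = 2 * m + 2 := length_cornerWord _ _ _ _
  have l3 : w₃.length = 2 * m + 2 := length_cornerWord _ _ _ _
  have l4 : w₄.length = 2 * m + 2 := length_cornerWord _ _ _ _
  have p0 : pathPoint (presentedGens gerstenRels) g w 0 = g := by
    simp [pathPoint, wordVal_nil]
  have p1 : pathPoint (presentedGens gerstenRels) g w (2 * m + 2) = g * gersVal w₁ := by
    rw [pathPoint, hw, ← l1, List.take_left]
  have p2 : pathPoint (presentedGens gerstenRels) g w (4 * m + 4) =
      g * gersVal w₁ * gersVal w₂ := by
    have e : w = (w₁ ++ w₂) ++ (w₃ ++ w₄) := by simp [hw]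
    have n : 4 * m + 4 = (w₁ ++ w₂).length := by simp only [List.length_append]; omega
    rw [pathPoint, e, n, List.take_left, wordVal_append, ← mul_assoc]
  have p3 : pathPoint (presentedGens gerstenRels) g w (6 * m + 6) =
      g * gersVal w₁ * gersVal w₂ * gersVal w₃ := by
    have e : w = (w₁ ++ w₂ ++ w₃) ++ w₄ := by simp [hw]
    have n : 6 * m + 6 = (w₁ ++ w₂ ++ w₃).length := by simp only [List.length_append]; omega
    rw [pathPoint, e, n, List.take_left, wordVal_append, wordVal_append]
    simp only [mul_assoc]
  have hloop : g * wordVal (presentedGens gerstenRels) w = g := by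
    apply site_injective
    apply Subtype.ext
    rw [s0, ← s4, hw, wordVal_append, wordVal_append, wordVal_append]
    simp only [mul_assoc]
  have hlen : w.length = 8 * m + 8 := by simp only [hw, List.length_append]; omega
  obtain ⟨h, u, hu, hul, hft⟩ := H g w (by rintro h0; rw [h0] at hlen; simp at hlen) hloop
  have near : ∀ {t : ℕ} {e : Crossing} {x y : ℤ}, e.inn = 0 →
      (site (pathPoint (presentedGens gerstenRels) g w t)).1 = (x, y, [e]) → y.natAbs = m →
      InBranch e (sitePath h u t) := fun he hs hy =>
    inBranch_of_wordDist_le (by omega) he hs hy (hft _)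
  have := length_ge_of_visits (m := m) hu (t₂ := 2 * m + 2) (t₃ := 4 * m + 4)
    (t₄ := 6 * m + 6) (by omega) (by omega)
    (near rfl (by rw [p0]; exact s0) (by simp)) (near rfl (by rw [p1]; exact s1) (by simp))
    (near rfl (by rw [p2]; exact s2) (by simp)) (near rfl (by rw [p3]; exact s3) (by simp))
  omega

/-! ### Areas of words -/

/-- The elements `u` and `v` of the free group differ by at most `k` applications of relators. -/
def AreaLE {α : Type*} (rels : Set (FreeGroup α)) (k : ℕ) (u v : FreeGroup α) : Prop :=
  ∃ j ≤ k, IsRelatorProduct rels j (u * v⁻¹)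

namespace AreaLE

variable {α : Type*} {rels : Set (FreeGroup α)} {k l : ℕ} {u v w p q : FreeGroup α}

theorem of_eq (h : u = v) : AreaLE rels 0 u v :=
  ⟨0, le_rfl, [], rfl, by simp [h], by simp⟩

theorem mono (h : AreaLE rels k u v) (hkl : k ≤ l) : AreaLE rels l u v := by
  obtain ⟨j, hj, h⟩ := h
  exact ⟨j, hj.trans hkl, h⟩

theorem of_mem (h : u⁻¹ * v ∈ rels) : AreaLE rels 1 u v :=
  ⟨1, le_rfl, [u * v⁻¹], rfl, by simp, by
    simp only [List.mem_singleton, forall_eq]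
    exact ⟨u, (u⁻¹ * v)⁻¹, .inr (by simpa using h), by group⟩⟩

theorem trans (h : AreaLE rels k u v) (h' : AreaLE rels l v w) : AreaLE rels (k + l) u w := by
  obtain ⟨_, hj, L, rfl, hp, hL⟩ := h
  obtain ⟨_, hj', L', rfl, hp', hL'⟩ := h'
  refine ⟨_, Nat.add_le_add hj hj', L ++ L', by simp, ?_, ?_⟩
  · rw [List.prod_append, hp, hp']; group
  · intro y hy
    rcases List.mem_append.1 hy with hy | hy
    · exact hL y hy
    · exact hL' y hy

theorem mul_left (h : AreaLE rels k u v) (p : FreeGroup α) : AreaLE rels k (p * u) (p * v) := by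
  obtain ⟨j, hj, L, hl, hp, hL⟩ := h
  refine ⟨j, hj, L.map (MulAut.conj p), by simpa using hl, ?_, ?_⟩
  · rw [← map_list_prod, hp, MulAut.conj_apply]; group
  · intro y hy
    obtain ⟨z, hz, rfl⟩ := List.mem_map.1 hy
    obtain ⟨g, r, hr, rfl⟩ := hL z hz
    exact ⟨p * g, r, hr, by rw [MulAut.conj_apply]; group⟩

theorem mul_right (h : AreaLE rels k u v) (q : FreeGroup α) :
    AreaLE rels k (u * q) (v * q) := by
  obtain ⟨j, hj, h⟩ := h
  exact ⟨j, hj, by rwa [mul_inv_rev, mul_assoc, mul_inv_cancel_left]⟩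

theorem symm (h : AreaLE rels k u v) : AreaLE rels k v u := by
  obtain ⟨j, hj, L, hl, hp, hL⟩ := h
  refine ⟨j, hj, (L.map (·⁻¹)).reverse, by simpa using hl, ?_, ?_⟩
  · rw [← List.prod_inv_reverse, hp]; group
  · intro y hy
    obtain ⟨z, hz, rfl⟩ := List.mem_map.1 (List.mem_reverse.1 hy)
    obtain ⟨g, r, hr, rfl⟩ := hL z hz
    exact ⟨g, r⁻¹, by rw [inv_inv]; exact hr.symm, by group⟩

theorem mul (h : AreaLE rels k u v) (h' : AreaLE rels l p q) :
    AreaLE rels (k + l) (u * p) (v * q) := (h.mul_right p).trans (h'.mul_left v)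

theorem inv (h : AreaLE rels k u v) : AreaLE rels k u⁻¹ v⁻¹ := by
  have := (h.symm.mul_left u⁻¹).mul_right v⁻¹
  simpa using this

theorem pow (h : AreaLE rels k u v) (n : ℕ) : AreaLE rels (n * k) (u ^ n) (v ^ n) := by
  induction n with
  | zero => exact of_eq (by simp) |>.mono (by simp)
  | succ n ih =>
    rw [pow_succ, pow_succ]
    exact (ih.mul h).mono (by rw [add_mul, one_mul])

theorem zpow (h : AreaLE rels k u v) (n : ℤ) :
    AreaLE rels (n.natAbs * k) (u ^ n) (v ^ n) := by
  rcases Int.eq_nat_or_neg n with ⟨m, rfl | rfl⟩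
  · simpa using h.pow m
  · simpa using (h.pow m).inv

end AreaLE

/-- The elements `u` and `v` of the free group commute up to `k` applications of relators. -/
abbrev CommArea {α : Type*} (rels : Set (FreeGroup α)) (k : ℕ) (u v : FreeGroup α) : Prop :=
  AreaLE rels k (u * v) (v * u)

namespace CommArea

variable {α : Type*} {rels : Set (FreeGroup α)} {k l : ℕ} {u v w : FreeGroup α}

theorem inv_right (h : CommArea rels k u v) : CommArea rels k u v⁻¹ := by
  have := ((AreaLE.symm h).mul_left v⁻¹).mul_right v⁻¹
  simpa [CommArea, mul_assoc] using this

theorem mul_right (h : CommArea rels k u v) (h' : CommArea rels l u w) :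
    CommArea rels (k + l) u (v * w) := by
  have h1 := AreaLE.mul_right h w
  have h2 := AreaLE.mul_left h' v
  rw [← mul_assoc] at h2
  have := h1.trans h2
  rwa [mul_assoc, ← mul_assoc v w u] at this

theorem pow_right (h : CommArea rels k u v) (n : ℕ) : CommArea rels (n * k) u (v ^ n) := by
  induction n with
  | zero => exact AreaLE.of_eq (by simp) |>.mono (by simp)
  | succ n ih =>
    rw [pow_succ]
    exact (ih.mul_right h).mono (by rw [add_mul, one_mul])

theorem zpow_right (h : CommArea rels k u v) (n : ℤ) :
    CommArea rels (n.natAbs * k) u (v ^ n) := by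
  rcases Int.eq_nat_or_neg n with ⟨m, rfl | rfl⟩
  · simpa using h.pow_right m
  · simpa using (h.pow_right m).inv_right

theorem congr_right (h : CommArea rels k u v) (h' : AreaLE rels l w v) :
    CommArea rels (k + 2 * l) u w :=
  (((h'.mul_left u).trans h).trans (h'.symm.mul_right u)).mono (by omega)

end CommArea

/-! ### Areas in the planes of Gersten's group -/

/-- The letters of the planes commute, at bounded cost. -/
theorem commArea_letters {y z : GerstenGen} (hy : y = .a ∨ y = .b ∨ y = .c ∨ y = .d)
    (hz : z = .a ∨ z = .b ∨ z = .c ∨ z = .d) :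
    CommArea gerstenRels 10 (gfree y) (gfree z) := by
  have c1 : AreaLE gerstenRels 1 (gfree .c) (gfree .a * gfree .b) :=
    .of_mem (by simp [gerstenRels])
  have c2 : AreaLE gerstenRels 1 (gfree .c) (gfree .b * gfree .a) :=
    .of_mem (by simp [gerstenRels])
  have d1 : AreaLE gerstenRels 1 (gfree .d) (gfree .a * (gfree .b)⁻¹) :=
    .of_mem (by simp [gerstenRels])
  have self : ∀ y, CommArea gerstenRels 0 (gfree y) (gfree y) := fun y => .of_eq rfl
  have ab : CommArea gerstenRels 2 (gfree .a) (gfree .b) := c1.symm.trans c2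
  have ba : CommArea gerstenRels 2 (gfree .b) (gfree .a) := AreaLE.symm ab
  have ac : CommArea gerstenRels 4 (gfree .a) (gfree .c) :=
    ((self _).mul_right ab).congr_right c1
  have ad : CommArea gerstenRels 4 (gfree .a) (gfree .d) :=
    ((self _).mul_right ab.inv_right).congr_right d1
  have bc : CommArea gerstenRels 4 (gfree .b) (gfree .c) :=
    (ba.mul_right (self _)).congr_right c1
  have bd : CommArea gerstenRels 4 (gfree .b) (gfree .d) :=
    (ba.mul_right (self _).inv_right).congr_right d1
  have ca : CommArea gerstenRels 4 (gfree .c) (gfree .a) := AreaLE.symm ac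
  have cb : CommArea gerstenRels 4 (gfree .c) (gfree .b) := AreaLE.symm bc
  -- Here `10 = 4 + 4 + 2`: two commutations, and two uses of the relator for `d`.
  have cd : CommArea gerstenRels 10 (gfree .c) (gfree .d) :=
    (ca.mul_right cb.inv_right).congr_right d1
  rcases hy with rfl | rfl | rfl | rfl <;> rcases hz with rfl | rfl | rfl | rfl
  · exact (self _).mono (by norm_num)
  · exact ab.mono (by norm_num)
  · exact ac.mono (by norm_num)
  · exact ad.mono (by norm_num)
  · exact ba.mono (by norm_num)
  · exact (self _).mono (by norm_num)
  · exact bc.mono (by norm_num)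
  · exact bd.mono (by norm_num)
  · exact ca.mono (by norm_num)
  · exact cb.mono (by norm_num)
  · exact (self _).mono (by norm_num)
  · exact cd
  · exact ad.symm.mono (by norm_num)
  · exact bd.symm.mono (by norm_num)
  · exact AreaLE.symm cd
  · exact (self _).mono (by norm_num)

theorem commArea_zpow {y z : GerstenGen} (hy : y = .a ∨ y = .b ∨ y = .c ∨ y = .d)
    (hz : z = .a ∨ z = .b ∨ z = .c ∨ z = .d) (i j : ℤ) :
    CommArea gerstenRels (10 * (i.natAbs * j.natAbs)) (gfree y ^ i) (gfree z ^ j) := by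
  have h1 := (commArea_letters hz hy).zpow_right i
  have h2 : CommArea gerstenRels _ (gfree y ^ i) (gfree z ^ j) :=
    CommArea.zpow_right (AreaLE.symm h1) j
  exact AreaLE.mono h2 (by nlinarith)

/-- A product of powers of the letters of the planes. -/
def planeProd (p q r s : ℤ) : FreeGroup GerstenGen :=
  gfree .c ^ p * gfree .d ^ q * gfree .a ^ r * gfree .b ^ s

/-- The power of `c` in the second factor moves past three powers, that of `d` past two and that of
`a` past one. The cost of each exchange is `10` times a distinct term of the expanded product. -/
theorem planeProd_mul (p q r s p' q' r' s' : ℤ) :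
    AreaLE gerstenRels (10 * ((p.natAbs + q.natAbs + r.natAbs + s.natAbs) *
      (p'.natAbs + q'.natAbs + r'.natAbs + s'.natAbs)))
      (planeProd p q r s * planeProd p' q' r' s')
      (planeProd (p + p') (q + q') (r + r') (s + s')) := by
  have com := @commArea_zpow
  have h1 := (((CommArea.mul_right (com (by simp) (by simp) p' q : CommArea _ _
    (gfree .c ^ p') (gfree .d ^ q)) (com (by simp) (by simp) p' r : CommArea _ _ _
    (gfree .a ^ r))).mul_right (com (by simp) (by simp) p' s : CommArea _ _ _
    (gfree .b ^ s))))
  have h2 := (CommArea.mul_right (com (by simp) (by simp) q' r : CommArea _ _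
    (gfree .d ^ q') (gfree .a ^ r)) (com (by simp) (by simp) q' s : CommArea _ _ _
    (gfree .b ^ s)))
  have h3 : CommArea _ _ (gfree .a ^ r') (gfree .b ^ s) := com (by simp) (by simp) r' s
  have e1 := ((AreaLE.symm h1).mul_left (gfree .c ^ p)).mul_right
    (gfree .d ^ q' * gfree .a ^ r' * gfree .b ^ s')
  have e2 := ((AreaLE.symm h2).mul_left (gfree .c ^ (p + p') * gfree .d ^ q)).mul_right
    (gfree .a ^ r' * gfree .b ^ s')
  have e3 := ((AreaLE.symm h3).mul_left (gfree .c ^ (p + p') * gfree .d ^ (q + q') *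
    gfree .a ^ r)).mul_right (gfree .b ^ s')
  have t1 : gfree .c ^ p * (gfree .c ^ p' * (gfree .d ^ q * gfree .a ^ r * gfree .b ^ s)) *
      (gfree .d ^ q' * gfree .a ^ r' * gfree .b ^ s') =
      gfree .c ^ (p + p') * gfree .d ^ q * (gfree .a ^ r * gfree .b ^ s * gfree .d ^ q') *
        (gfree .a ^ r' * gfree .b ^ s') := by group
  have t2 : gfree .c ^ (p + p') * gfree .d ^ q * (gfree .d ^ q' * (gfree .a ^ r * gfree .b ^ s)) *
        (gfree .a ^ r' * gfree .b ^ s') =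
      gfree .c ^ (p + p') * gfree .d ^ (q + q') * gfree .a ^ r * (gfree .b ^ s * gfree .a ^ r') *
        gfree .b ^ s' := by group
  rw [t1] at e1
  rw [t2] at e2
  have e := (e1.trans e2).trans e3
  have t3 : planeProd p q r s * planeProd p' q' r' s' =
      gfree .c ^ p * (gfree .d ^ q * gfree .a ^ r * gfree .b ^ s * gfree .c ^ p') *
      (gfree .d ^ q' * gfree .a ^ r' * gfree .b ^ s') := by simp only [planeProd]; group
  have t4 : planeProd (p + p') (q + q') (r + r') (s + s') =
      gfree .c ^ (p + p') * gfree .d ^ (q + q') * gfree .a ^ r * (gfree .a ^ r' * gfree .b ^ s) *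
        gfree .b ^ s' := by simp only [planeProd]; group
  rw [t3, t4]
  refine e.mono ?_
  generalize p.natAbs = a, q.natAbs = b, r.natAbs = c, s.natAbs = d, p'.natAbs = a',
    q'.natAbs = b', r'.natAbs = c', s'.natAbs = d'
  ring_nf
  omega

/-- Absorbing one more letter into `a ^ n * b ^ (m * n)` costs `O(n)`, hence `50 n²` for positive
powers. Inversion reverses the two factors, and reordering them costs another `10 n²`. -/
theorem diag_pow_area {y : GerstenGen} {m : ℤ} (hm : m.natAbs ≤ 1)
    (h : AreaLE gerstenRels 1 (gfree y) (gfree .a * gfree .b ^ m)) (n : ℤ) :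
    AreaLE gerstenRels (60 * (n.natAbs * n.natAbs)) (gfree y ^ n) (planeProd 0 0 n (m * n)) := by
  have key : ∀ n : ℕ, AreaLE gerstenRels (50 * (n * n)) (gfree y ^ n)
      (planeProd 0 0 n (m * n)) := by
    intro n
    induction n with
    | zero => exact .of_eq (by simp [planeProd])
    | succ n ih =>
      have h0 : gfree .a * gfree .b ^ m = planeProd 0 0 1 m := by simp [planeProd]
      rw [h0] at h
      have h1 := (ih.mul h).trans (planeProd_mul 0 0 n (m * n) 0 0 1 m)
      rw [pow_succ]
      have e : planeProd 0 0 ((n + 1 : ℕ) : ℤ) (m * ((n + 1 : ℕ) : ℤ)) =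
          planeProd (0 + 0) (0 + 0) (n + 1) (m * n + m) := by
        push_cast; ring_nf
      rw [e]
      refine h1.mono ?_
      have : (m * n).natAbs ≤ n := by
        rw [Int.natAbs_mul]; simpa using Nat.mul_le_mul_right n hm
      simp only [Int.natAbs_zero, Int.natAbs_natCast, Int.natAbs_one, zero_add]
      have : (n + (m * n).natAbs) * (1 + m.natAbs) ≤ (n + n) * 2 :=
        Nat.mul_le_mul (by omega) (by omega)
      nlinarith
  rcases Int.eq_nat_or_neg n with ⟨k, rfl | rfl⟩
  · have := key k
    rw [Int.natAbs_natCast, zpow_natCast]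
    exact this.mono (by nlinarith)
  · have h1 := (key k).inv
    have h2 := commArea_zpow (y := .b) (z := .a) (by simp) (by simp) (-(m * k)) (-k)
    have e1 : (planeProd 0 0 k (m * k))⁻¹ = gfree .b ^ (-(m * k)) * gfree .a ^ (-k : ℤ) := by
      simp [planeProd]
    have e2 : planeProd 0 0 (-k) (m * -k) = gfree .a ^ (-k : ℤ) * gfree .b ^ (-(m * k)) := by
      simp [planeProd]
    have e3 : gfree y ^ (-(k : ℤ)) = (gfree y ^ k)⁻¹ := by simp
    rw [e1] at h1
    rw [e2, e3]
    refine (h1.trans h2).mono ?_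
    have : (-(m * k)).natAbs ≤ k := by
      rw [Int.natAbs_neg, Int.natAbs_mul]; simpa using Nat.mul_le_mul_right k hm
    simp only [Int.natAbs_neg, Int.natAbs_natCast] at *
    nlinarith

/-- The two equations say that the point of the plane is the origin; rewriting `c` and `d` through
`a` and `b` makes the powers cancel. -/
theorem planeProd_null {p q r s : ℤ} (h1 : p + q + r = 0) (h2 : p - q + s = 0) {n : ℕ}
    (hn : p.natAbs + q.natAbs + r.natAbs + s.natAbs ≤ n) :
    AreaLE gerstenRels (100 * (n * n)) (planeProd p q r s) 1 := by
  have c1 : AreaLE gerstenRels 1 (gfree .c) (gfree .a * gfree .b ^ (1 : ℤ)) := by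
    rw [zpow_one]; exact .of_mem (by simp [gerstenRels])
  have d1 : AreaLE gerstenRels 1 (gfree .d) (gfree .a * gfree .b ^ (-1 : ℤ)) := by
    rw [zpow_neg_one]; exact .of_mem (by simp [gerstenRels])
  have a1 := diag_pow_area (by simp) c1 p
  have a2 := diag_pow_area (by simp) d1 q
  have a3 := (a1.mul a2).trans (planeProd_mul 0 0 p (1 * p) 0 0 q (-1 * q))
  have a4 := (a3.mul_right (gfree .a ^ r * gfree .b ^ s))
  have a5 := planeProd_mul (0 + 0) (0 + 0) (p + q) (1 * p + -1 * q) 0 0 r s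
  have e1 : planeProd 0 0 r s = gfree .a ^ r * gfree .b ^ s := by simp [planeProd]
  have e2 : planeProd (0 + 0 + 0) (0 + 0 + 0) (p + q + r) (1 * p + -1 * q + s) = 1 := by
    rw [h1, show 1 * p + -1 * q + s = 0 by omega]; simp [planeProd]
  have e3 : planeProd p q r s = gfree .c ^ p * gfree .d ^ q * (gfree .a ^ r * gfree .b ^ s) := by
    simp [planeProd, mul_assoc]
  rw [e2, e1] at a5
  rw [e3]
  refine (a4.trans a5).mono ?_
  have b1 : (p + q).natAbs ≤ p.natAbs + q.natAbs := by omega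
  have b2 : (1 * p + -1 * q).natAbs ≤ p.natAbs + q.natAbs := by omega
  have b3 : (1 * p).natAbs = p.natAbs := by simp
  have b4 : (-1 * q).natAbs = q.natAbs := by simp
  simp only [b3, b4, Int.natAbs_zero, zero_add, add_zero]
  have b5 : ((p + q).natAbs + (1 * p + -1 * q).natAbs) * (r.natAbs + s.natAbs) ≤
      (2 * (p.natAbs + q.natAbs)) * (r.natAbs + s.natAbs) := Nat.mul_le_mul_right _ (by omega)
  have b6 := Nat.mul_le_mul hn hn
  generalize p.natAbs = a at *
  generalize q.natAbs = b at *
  generalize r.natAbs = c at *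
  generalize s.natAbs = d at *
  nlinarith [Nat.zero_le (a * b), Nat.zero_le (a * c), Nat.zero_le (a * d), Nat.zero_le (b * c),
    Nat.zero_le (b * d), Nat.zero_le (c * d), Nat.zero_le (c * c), Nat.zero_le (d * d)]

/-- The exponent of `c` in the normal form of `(x, y)`. -/
def diagPart (x y : ℤ) : ℤ := min (max x 0) (max y 0) - min (max (-x) 0) (max (-y) 0)

theorem diagPart_bound (x y : ℤ) : (diagPart x y).natAbs ≤ max x.natAbs y.natAbs := by
  simp only [diagPart]; omega

/-- The minimum of the positive parts is `1`-Lipschitz in the sup norm, and `diagPart` is a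
difference of two such functions. This makes the correction in a product of normal forms linear in
the smaller factor. -/
theorem diagPart_lipschitz (x y x' y' : ℤ) :
    (diagPart (x + x') (y + y') - diagPart x y).natAbs ≤ 2 * max x'.natAbs y'.natAbs := by
  have h1 : ∀ x y x' y' : ℤ, (min (max (x + x') 0) (max (y + y') 0) -
      min (max x 0) (max y 0)).natAbs ≤ max x'.natAbs y'.natAbs := by
    intro x y x' y'; omega
  have h2 := h1 x y x' y'
  have h3 := h1 (-x) (-y) (-x') (-y')
  simp only [Int.natAbs_neg, ← neg_add] at h3
  simp only [diagPart]
  generalize min (max (x + x') 0) (max (y + y') 0) = a at *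
  generalize min (max (-(x + x')) 0) (max (-(y + y')) 0) = b at *
  generalize min (max x 0) (max y 0) = c at *
  generalize min (max (-x) 0) (max (-y) 0) = d at *
  clear h1
  omega

/-- The normal form of the element `(x, y)` of the base plane. -/
def planeNF (x y : ℤ) : FreeGroup GerstenGen :=
  planeProd (diagPart x y) (diagPart x (-y)) (x - diagPart x y - diagPart x (-y))
    (y - diagPart x y + diagPart x (-y))

/-- The bound is by the product of the norms, not by the square of their sum; a subdivision then
costs the cross term of a square and nothing accumulates. Adding exponents respects this bound, and
the exponents miss those of the normal form by a null combination of size `O(min M M')`. -/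
theorem planeNF_mul (x y x' y' : ℤ) :
    AreaLE gerstenRels (36000 * (max x.natAbs y.natAbs * max x'.natAbs y'.natAbs))
      (planeNF x y * planeNF x' y') (planeNF (x + x') (y + y')) := by
  have a1 := diagPart_bound x y
  have a2 := diagPart_bound x (-y)
  have a3 := diagPart_bound x' y'
  have a4 := diagPart_bound x' (-y')
  have a5 := diagPart_lipschitz x y x' y'
  have a6 := diagPart_lipschitz x (-y) x' (-y')
  have a7 := diagPart_lipschitz x' y' x y
  have a8 := diagPart_lipschitz x' (-y') x (-y)
  rw [add_comm x' x, add_comm y' y] at a7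
  rw [add_comm x' x, add_comm (-y') (-y)] at a8
  rw [← neg_add] at a6 a8
  simp only [Int.natAbs_neg] at a2 a4 a6 a8
  have hx : x.natAbs ≤ max x.natAbs y.natAbs := le_max_left _ _
  have hy : y.natAbs ≤ max x.natAbs y.natAbs := le_max_right _ _
  have hx' : x'.natAbs ≤ max x'.natAbs y'.natAbs := le_max_left _ _
  have hy' : y'.natAbs ≤ max x'.natAbs y'.natAbs := le_max_right _ _
  simp only [planeNF]
  generalize diagPart (x + x') (y + y') = P at *
  generalize diagPart (x + x') (-(y + y')) = Q at *
  generalize diagPart x y = p at *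
  generalize diagPart x (-y) = q at *
  generalize diagPart x' y' = p' at *
  generalize diagPart x' (-y') = q' at *
  generalize max x.natAbs y.natAbs = M at *
  generalize max x'.natAbs y'.natAbs = M' at *
  -- The defects of additivity of the exponents of `c` and `d`. The Lipschitz bound with respect to
  -- either factor bounds them by three times the smaller norm.
  obtain ⟨Δ, hΔ⟩ : ∃ Δ, P = p + p' + Δ := ⟨P - p - p', by ring⟩
  obtain ⟨E, hE⟩ : ∃ E, Q = q + q' + E := ⟨Q - q - q', by ring⟩
  have hΔM : Δ.natAbs ≤ 3 * min M M' := by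
    have h1 : Δ.natAbs ≤ 3 * M' := by clear * - a5 a3 hΔ; omega
    have h2 : Δ.natAbs ≤ 3 * M := by clear * - a7 a1 hΔ; omega
    clear * - h1 h2; omega
  have hEM : E.natAbs ≤ 3 * min M M' := by
    have h1 : E.natAbs ≤ 3 * M' := by clear * - a6 a4 hE; omega
    have h2 : E.natAbs ≤ 3 * M := by clear * - a8 a2 hE; omega
    clear * - h1 h2; omega
  have t1 : (x - p - q).natAbs ≤ 3 * M := by clear * - hx a1 a2; omega
  have t2 : (y - p + q).natAbs ≤ 3 * M := by clear * - hy a1 a2; omega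
  have t3 : (x' - p' - q').natAbs ≤ 3 * M' := by clear * - hx' a3 a4; omega
  have t4 : (y' - p' + q').natAbs ≤ 3 * M' := by clear * - hy' a3 a4; omega
  have tri : ∀ a b : ℤ, (a + b).natAbs ≤ a.natAbs + b.natAbs := Int.natAbs_add_le
  have t5 : (-Δ - E).natAbs ≤ Δ.natAbs + E.natAbs := by clear * -; omega
  have t6 : (-Δ + E).natAbs ≤ Δ.natAbs + E.natAbs := by clear * -; omega
  clear a5 a6 a7 a8
  have m1 := planeProd_mul p q (x - p - q) (y - p + q) p' q' (x' - p' - q') (y' - p' + q')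
  have m2 := planeProd_mul (p + p') (q + q') (x - p - q + (x' - p' - q'))
    (y - p + q + (y' - p' + q')) Δ E (-Δ - E) (-Δ + E)
  have m3 := planeProd_null (p := Δ) (q := E) (r := -Δ - E) (s := -Δ + E) (n := 18 * min M M')
    (by ring) (by ring) (by clear * - t5 t6 hΔM hEM; omega)
  have m4 := m3.mul_left (planeProd (p + p') (q + q') (x - p - q + (x' - p' - q'))
    (y - p + q + (y' - p' + q')))
  rw [mul_one] at m4
  have e : planeProd P Q (x + x' - P - Q) (y + y' - P + Q) = planeProd (p + p' + Δ) (q + q' + E)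
      (x - p - q + (x' - p' - q') + (-Δ - E)) (y - p + q + (y' - p' + q') + (-Δ + E)) := by
    rw [hΔ, hE]; ring_nf
  rw [e]
  refine ((m1.trans m4.symm).trans m2).mono ?_
  have n1 : p.natAbs + q.natAbs + (x - p - q).natAbs + (y - p + q).natAbs ≤ 8 * M := by
    clear * - a1 a2 t1 t2; linarith
  have n2 : p'.natAbs + q'.natAbs + (x' - p' - q').natAbs + (y' - p' + q').natAbs ≤ 8 * M' := by
    clear * - a3 a4 t3 t4; linarith
  have n3 : (p + p').natAbs + (q + q').natAbs + (x - p - q + (x' - p' - q')).natAbs +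
      (y - p + q + (y' - p' + q')).natAbs ≤ 8 * (M + M') := by
    linarith [tri p p', tri q q', tri (x - p - q) (x' - p' - q'), tri (y - p + q) (y' - p' + q')]
  have n4 : Δ.natAbs + E.natAbs + (-Δ - E).natAbs + (-Δ + E).natAbs ≤ 18 * min M M' := by
    clear * - t5 t6 hΔM hEM; linarith
  -- The costs are `10 * 64 * (M * M')`, `10 * (8 * 18) * ((M + M') * min M M')` and `100 * 18 ^ 2 *
  -- min M M' ^ 2`, together at most `(640 + 2880 + 32400) * (M * M')`.
  have k1 := Nat.mul_le_mul n1 n2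
  have k2 := Nat.mul_le_mul n3 n4
  have k3 : min M M' * min M M' ≤ M * M' := Nat.mul_le_mul (min_le_left _ _) (min_le_right _ _)
  have k4 : (M + M') * min M M' ≤ 2 * (M * M') := by
    have h1 : M * min M M' ≤ M * M' := Nat.mul_le_mul_left _ (min_le_right _ _)
    have h2 : M' * min M M' ≤ M' * M := Nat.mul_le_mul_left _ (min_le_left _ _)
    nlinarith
  nlinarith

/-- On the glued lines the normal forms are powers of the single letters `a`, `c` and `d`, so
conjugation by a stable letter is a corridor of `|n|` relators. -/
theorem planeNF_line (σ up : Bool) (n : ℤ) :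
    AreaLE gerstenRels n.natAbs
      (gfree (if σ then .s else .t) ^ (if up then (1 : ℤ) else -1) *
        planeNF n (exitSlope σ (!up) * n) *
        gfree (if σ then .s else .t) ^ (if up then (-1 : ℤ) else 1))
      (planeNF n (exitSlope σ up * n)) := by
  have d1 : diagPart n n = n := by simp only [diagPart]; omega
  have d2 : diagPart n (-n) = 0 := by simp only [diagPart]; omega
  have d3 : diagPart n 0 = 0 := by simp only [diagPart]; omega
  have nf0 : planeNF n 0 = gfree .a ^ n := by simp [planeNF, planeProd, d3]
  have nf1 : planeNF n n = gfree .c ^ n := by simp [planeNF, planeProd, d1, d2]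
  have nf2 : planeNF n (-n) = gfree .d ^ n := by simp [planeNF, planeProd, d1, d2]
  have key : ∀ y z, (gfree y)⁻¹ * ((gfree z)⁻¹ * gfree .a * gfree z) ∈ gerstenRels →
      AreaLE gerstenRels n.natAbs ((gfree z)⁻¹ * gfree .a ^ n * gfree z) (gfree y ^ n) := by
    intro y z h
    have h1 := (AreaLE.of_mem h).symm.zpow n
    have h2 := conj_zpow (a := (gfree z)⁻¹) (b := gfree .a) (i := n)
    rw [inv_inv] at h2
    rwa [h2, mul_one] at h1
  have key' : ∀ y z, (gfree y)⁻¹ * ((gfree z)⁻¹ * gfree .a * gfree z) ∈ gerstenRels →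
      AreaLE gerstenRels n.natAbs (gfree z * gfree y ^ n * (gfree z)⁻¹) (gfree .a ^ n) := by
    intro y z h
    have h1 := (((key y z h).symm.mul_left (gfree z)).mul_right (gfree z)⁻¹)
    simpa [mul_assoc] using h1
  cases σ <;> cases up <;> simp only [exitSlope, stableSign, Bool.not_true, Bool.not_false,
    if_true, if_false, Bool.false_eq_true, zero_mul, one_mul, neg_one_mul, nf0, nf1, nf2, zpow_one,
    zpow_neg_one]
  · exact key .d .t (by simp [gerstenRels])
  · exact key' .d .t (by simp [gerstenRels])
  · exact key .c .s (by simp [gerstenRels])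
  · exact key' .c .s (by simp [gerstenRels])

/-! ### The Dehn function is at most quadratic -/

/-- The letter of the alphabet for a stable letter or its inverse. -/
def stableSymbol (σ up : Bool) : GerstenGen × Bool := (if σ then .s else .t, up)

theorem gersVal_stableSymbol (σ up : Bool) : gersVal [stableSymbol σ up] = crossLetter σ up := by
  cases σ <;> cases up <;> simp [gersVal, wordVal, stableSymbol, crossLetter, stableLetter]

theorem letter_cases (l : GerstenGen × Bool) :
    (∃ u v : ℤ, max u.natAbs v.natAbs ≤ 1 ∧ gersVal [l] = planeElt u v ∧
      FreeGroup.mk [l] = planeNF u v) ∨ ∃ σ up, l = stableSymbol σ up := by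
  obtain ⟨ha, hb, hc, hd⟩ := gen_eq_planeElt
  have pos : ∀ y, gersVal [(y, true)] = presentedGens gerstenRels y := by simp [gersVal, wordVal]
  have neg : ∀ y, gersVal [(y, false)] = (presentedGens gerstenRels y)⁻¹ := by
    simp [gersVal, wordVal]
  have mpos : ∀ y : GerstenGen, FreeGroup.mk [(y, true)] = gfree y := fun y => rfl
  have mneg : ∀ y : GerstenGen, FreeGroup.mk [(y, false)] = (gfree y)⁻¹ := fun y => rfl
  obtain ⟨y, b⟩ := l
  cases y
  case s => exact .inr ⟨true, b, rfl⟩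
  case t => exact .inr ⟨false, b, rfl⟩
  all_goals left
  all_goals cases b
  · exact ⟨-1, 0, by simp, by rw [neg, ha, planeElt_inv]; rfl,
      by rw [mneg]; simp [planeNF, planeProd, diagPart]⟩
  · exact ⟨1, 0, by simp, by rw [pos, ha], by rw [mpos]; simp [planeNF, planeProd, diagPart]⟩
  · exact ⟨0, -1, by simp, by rw [neg, hb, planeElt_inv]; rfl,
      by rw [mneg]; simp [planeNF, planeProd, diagPart]⟩
  · exact ⟨0, 1, by simp, by rw [pos, hb], by rw [mpos]; simp [planeNF, planeProd, diagPart]⟩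
  · exact ⟨-1, -1, by simp, by rw [neg, hc, planeElt_inv],
      by rw [mneg]; simp [planeNF, planeProd, diagPart]⟩
  · exact ⟨1, 1, by simp, by rw [pos, hc], by rw [mpos]; simp [planeNF, planeProd, diagPart]⟩
  · exact ⟨-1, 1, by simp, by rw [neg, hd, planeElt_inv]; rfl,
      by rw [mneg]; simp [planeNF, planeProd, diagPart]⟩
  · exact ⟨1, -1, by simp, by rw [pos, hd], by rw [mpos]; simp [planeNF, planeProd, diagPart]⟩

theorem site_planeElt (x y : ℤ) : (site (planeElt x y)).1 = (x, y, []) := by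
  have := site_mul_planeElt_eq (g := 1) (x := 0) (y := 0) (st := []) (by rw [site_one]; rfl) x y
  simpa using this

theorem site_crossLetter (σ up : Bool) : (site (crossLetter σ up)).1 = (0, 0, [⟨σ, up, 0⟩]) := by
  have := site_mul_crossLetter 1 σ up
  rw [one_mul, site_one] at this
  rw [this]
  simp [originSite, crossRaw]

/-- The point reached by one letter determines which stable letter it is, so an equality in the
group can be turned into an equality of letters. -/
theorem eq_stableSymbol {l : GerstenGen × Bool} {σ up : Bool}
    (h : gersVal [l] = crossLetter σ up) : l = stableSymbol σ up := by
  have h2 := site_crossLetter σ up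
  rw [← h] at h2
  rcases letter_cases l with ⟨u, v, -, h1, -⟩ | ⟨σ', up', rfl⟩
  · rw [h1, site_planeElt] at h2
    simp at h2
  · rw [gersVal_stableSymbol, site_crossLetter] at h2
    simp only [Prod.mk.injEq, List.cons.injEq, Crossing.mk.injEq] at h2
    obtain ⟨-, -, ⟨rfl, rfl, -⟩, -⟩ := h2
    rfl

theorem plane_norm_le {w : List (GerstenGen × Bool)} {x y : ℤ} (h : gersVal w = planeElt x y) :
    max x.natAbs y.natAbs ≤ w.length := by
  have := plane_isometric (g := 1) (w := w) (x := 0) (y := 0) (x' := x) (y' := y) (st := [])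
    (by rw [site_one]; rfl) (by rw [one_mul, h, site_planeElt])
  simpa using this

/-- A word that starts with a stable letter and represents an element of the base plane contains
the inverse letter after a word that represents an element of the boundary line. -/
theorem exists_pinch {σ up : Bool} {w : List (GerstenGen × Bool)} {x y : ℤ}
    (h : gersVal (stableSymbol σ up :: w) = planeElt x y) :
    ∃ w₁ w₂ q, w = w₁ ++ stableSymbol σ (!up) :: w₂ ∧
      gersVal w₁ = planeElt q (exitSlope σ (!up) * q) ∧
      gersVal w₂ = planeElt (x - q) (y - exitSlope σ up * q) := by
  set e : Crossing := ⟨σ, up, 0⟩ with he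
  set W := stableSymbol σ up :: w with hW
  have hs : gersVal [stableSymbol σ up] = crossLetter σ up := gersVal_stableSymbol σ up
  have p1 : sitePath 1 W 1 = (0, 0, [e]) := by
    have : pathPoint (presentedGens gerstenRels) 1 W 1 = crossLetter σ up := by
      rw [← hs]; simp [pathPoint, hW, gersVal]
    rw [sitePath, this, site_crossLetter]
  have pend : sitePath 1 W W.length = (x, y, []) := by
    have : pathPoint (presentedGens gerstenRels) 1 W W.length = planeElt x y := by
      rw [← h]; simp [pathPoint, gersVal]
    rw [sitePath, this, site_planeElt]
  -- After one letter the path is in the branch beyond a line through the origin, and it ends in the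
  -- base plane; its return through this line is the pinch.
  obtain ⟨τ, q, h1, h2, h3, h4⟩ := exists_leave_branch (e := e) (sitePath_step 1 W)
    (s := 1) (t := W.length) (by simp [hW]) (by rw [p1]; exact List.suffix_refl _)
    (by rw [pend]; simp [InBranch])
  obtain ⟨n, rfl⟩ := Nat.exists_eq_add_of_le h1
  have hn : n < w.length := by simp [hW] at h2; omega
  have hdrop := List.drop_eq_getElem_cons hn
  have hsplit : w = w.take n ++ w[n] :: w.drop (n + 1) := by
    rw [← hdrop, List.take_append_drop]
  have elt : ∀ g : GerstenGroup, siteElt (site g).1 = g := siteElt_site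
  have v1 : gersVal (w.take n) = planeElt q (exitSlope σ (!up) * q) := by
    have h5 := elt (pathPoint (presentedGens gerstenRels) 1 W (1 + n))
    change siteElt (sitePath 1 W (1 + n)) = _ at h5
    rw [h3] at h5
    have h6 : pathPoint (presentedGens gerstenRels) 1 W (1 + n) =
        crossLetter σ up * gersVal (w.take n) := by
      rw [pathPoint, hW, Nat.add_comm 1 n, List.take_succ_cons, one_mul, wordVal_cons, ← hs]
    rw [h6] at h5
    have h7 : siteElt (q, e.inn * q, [e]) =
        crossLetter σ up * planeElt q (exitSlope σ (!up) * q) := by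
      simp [siteElt, stackElt, he, Crossing.inn, planeElt_zero]
    rw [h7] at h5
    exact (mul_left_cancel h5).symm
  have v2 : gersVal [w[n]] = crossLetter σ (!up) := by
    have h5 := elt (pathPoint (presentedGens gerstenRels) 1 W (1 + n + 1))
    change siteElt (sitePath 1 W (1 + n + 1)) = _ at h5
    rw [h4] at h5
    have h6 : pathPoint (presentedGens gerstenRels) 1 W (1 + n + 1) =
        crossLetter σ up * (gersVal (w.take n) * gersVal [w[n]]) := by
      rw [pathPoint, hW, Nat.add_comm 1 n, List.take_succ_cons, one_mul, wordVal_cons, ← hs,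
        List.take_succ_eq_append_getElem hn, wordVal_append]
    have h7 : siteElt (q, e.out * q + e.offset, []) = planeElt q (exitSlope σ up * q) := by
      simp [siteElt, stackElt, he, Crossing.out]
    rw [h6, h7, v1, ← mul_assoc, ← planeElt_mul_crossLetter, mul_assoc] at h5
    have h8 := mul_left_cancel (h5.symm.trans (mul_one _).symm)
    rw [← crossLetter_mul_not σ up] at h8
    exact mul_left_cancel h8
  have v3 := eq_stableSymbol v2
  refine ⟨w.take n, w.drop (n + 1), q, by rw [← v3]; exact hsplit, v1, ?_⟩
  have h5 : gersVal W = planeElt q (exitSlope σ up * q) * gersVal (w.drop (n + 1)) := by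
    have h6 : gersVal W =
        crossLetter σ up * (gersVal (w.take n) * (gersVal [w[n]] * gersVal (w.drop (n + 1)))) := by
      have h7 : gersVal w = gersVal (w.take n) * (gersVal [w[n]] * gersVal (w.drop (n + 1))) := by
        conv_lhs => rw [hsplit]
        rw [gersVal, wordVal_append, wordVal_cons _ w[n] (List.drop (n + 1) w)]
      rw [hW, ← hs, ← h7, gersVal, wordVal_cons _ (stableSymbol σ up) w]
    rw [h6, v1, v2]
    simp only [← mul_assoc]
    rw [← planeElt_mul_crossLetter, mul_assoc (planeElt _ _), crossLetter_mul_not, mul_one]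
  rw [h5, ← eq_inv_mul_iff_mul_eq, planeElt_inv, planeElt_mul] at h
  rw [h]
  congr 1 <;> ring

theorem mk_cons (l : GerstenGen × Bool) (w : List (GerstenGen × Bool)) :
    FreeGroup.mk (l :: w) = FreeGroup.mk [l] * FreeGroup.mk w := by
  rw [FreeGroup.mul_mk]; rfl

/-- Induction on the length. A plane letter is multiplied into the normal form of the rest. A stable
letter is cancelled against its partner at a pinch, and the two remaining subwords are put into
normal form separately. -/
theorem area_planeNF (n : ℕ) : ∀ (w : List (GerstenGen × Bool)) (x y : ℤ), w.length ≤ n →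
    gersVal w = planeElt x y →
    AreaLE gerstenRels (36000 * (w.length * w.length)) (FreeGroup.mk w) (planeNF x y) := by
  induction n with
  | zero =>
    intro w x y hw h
    obtain rfl := List.length_eq_zero_iff.1 (Nat.le_zero.1 hw)
    have := plane_norm_le h
    simp only [List.length_nil] at this
    obtain rfl : x = 0 := by omega
    obtain rfl : y = 0 := by omega
    exact (AreaLE.of_eq (by simp [planeNF, planeProd, diagPart]; rfl)).mono (by simp)
  | succ n ih =>
    intro w x y hw h
    rcases w with _ | ⟨l, w⟩
    · exact ih [] x y (by simp) h
    rcases letter_cases l with ⟨u, v, huv, h1, h2⟩ | ⟨σ, up, rfl⟩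
    · have h3 : gersVal w = planeElt (x - u) (y - v) := by
        rw [gersVal, wordVal_cons, ← gersVal, h1, ← eq_inv_mul_iff_mul_eq, planeElt_inv,
          planeElt_mul] at h
        refine h.trans ?_; congr 1 <;> ring
      have h4 := ih w _ _ (by simpa using hw) h3
      have h5 := (h4.mul_left (planeNF u v)).trans (planeNF_mul u v (x - u) (y - v))
      rw [mk_cons, h2]
      rw [add_sub_cancel, add_sub_cancel] at h5
      refine h5.mono ?_
      -- The letter has norm at most `1`, so it costs at most `36000` times the length of the rest,
      -- which the growth of the square absorbs.
      have h6 := Nat.mul_le_mul huv (plane_norm_le h3)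
      simp only [List.length_cons]
      nlinarith
    · obtain ⟨w₁, w₂, q, rfl, h1, h2⟩ := exists_pinch h
      simp only [List.length_cons, List.length_append] at hw ⊢
      have a1 := ih w₁ _ _ (by omega) h1
      have a2 := ih w₂ _ _ (by omega) h2
      have e1 : ∀ up, FreeGroup.mk [stableSymbol σ up] =
          gfree (if σ then .s else .t) ^ (if up then (1 : ℤ) else -1) := by
        intro up
        cases up <;> simp only [stableSymbol, if_true, if_false, Bool.false_eq_true, zpow_one,
          zpow_neg_one] <;> rfl
      have e2 : FreeGroup.mk [stableSymbol σ (!up)] =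
          gfree (if σ then .s else .t) ^ (if up then (-1 : ℤ) else 1) := by
        rw [e1]; cases up <;> rfl
      have b1 := ((a1.mul_left (FreeGroup.mk [stableSymbol σ up])).mul_right
        (FreeGroup.mk [stableSymbol σ (!up)]))
      have b2 := planeNF_line σ up q
      rw [← e1, ← e2] at b2
      have b3 := ((b1.trans b2).mul a2).trans (planeNF_mul _ _ _ _)
      rw [add_sub_cancel, add_sub_cancel] at b3
      have e3 : FreeGroup.mk (stableSymbol σ up :: (w₁ ++ stableSymbol σ (!up) :: w₂)) =
          FreeGroup.mk [stableSymbol σ up] * FreeGroup.mk w₁ *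
            FreeGroup.mk [stableSymbol σ (!up)] * FreeGroup.mk w₂ := by
        simp only [FreeGroup.mul_mk]; simp
      rw [e3]
      refine b3.mono ?_
      have c1 := plane_norm_le h1
      have c2 := plane_norm_le h2
      have c3 : q.natAbs ≤ w₁.length := (le_max_left _ _).trans c1
      have c4 : max q.natAbs (exitSlope σ up * q).natAbs ≤ w₁.length := by
        rcases exitSlope_cases σ up with h | h | h <;> rw [h] <;> omega
      -- With `n₁`, `n₂` the lengths of the subwords, the total is at most `36000 * (n₁² + n₂² + n₁
      -- * n₂) + n₁`, below `36000 * (n₁ + n₂ + 2)²`.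
      have c5 := Nat.mul_le_mul c4 c2
      nlinarith

theorem gersVal_eq_mk (w : List (GerstenGen × Bool)) :
    gersVal w = PresentedGroup.mk gerstenRels (FreeGroup.mk w) := by
  induction w with
  | nil => simp [gersVal, wordVal_nil, ← FreeGroup.one_eq_mk]
  | cons l w ih =>
    rw [mk_cons, map_mul, ← ih, gersVal, wordVal_cons]
    congr 1
    obtain ⟨y, b⟩ := l
    cases b
    · simp only [wordVal, List.map_cons, List.map_nil, List.prod_cons, List.prod_nil, mul_one,
        Bool.false_eq_true, if_false]
      exact (map_inv (PresentedGroup.mk gerstenRels) (FreeGroup.of y)).symm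
    · simp only [wordVal, List.map_cons, List.map_nil, List.prod_cons, List.prod_nil, mul_one,
        if_true]
      rfl

/-- The quadratic isoperimetric inequality. -/
theorem exists_isRelatorProduct {w : List (GerstenGen × Bool)}
    (h : PresentedGroup.mk gerstenRels (FreeGroup.mk w) = 1) :
    ∃ j ≤ 36000 * (w.length * w.length), IsRelatorProduct gerstenRels j (FreeGroup.mk w) := by
  rw [← gersVal_eq_mk, ← planeElt_zero] at h
  obtain ⟨j, hj, hr⟩ := area_planeNF _ w 0 0 le_rfl h
  have e : planeNF 0 0 = 1 := by simp [planeNF, planeProd, diagPart]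
  rw [e, inv_one, mul_one] at hr
  exact ⟨j, hj, hr⟩

instance : Finite GerstenGen :=
  Finite.of_surjective (![.a, .b, .c, .d, .s, .t] : Fin 6 → GerstenGen) (by
    intro y
    cases y
    · exact ⟨0, rfl⟩
    · exact ⟨1, rfl⟩
    · exact ⟨2, rfl⟩
    · exact ⟨3, rfl⟩
    · exact ⟨4, rfl⟩
    · exact ⟨5, rfl⟩)

theorem dehnFunction_gersten_le (n : ℕ) : dehnFunction gerstenRels n ≤ 36000 * n ^ 2 := by
  refine csSup_le' ?_
  rintro k ⟨w, hw, h, rfl⟩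
  obtain ⟨j, hj, hr⟩ := exists_isRelatorProduct h
  calc relArea gerstenRels (FreeGroup.mk w) ≤ j := Nat.sInf_le hr
    _ ≤ 36000 * (w.length * w.length) := hj
    _ ≤ 36000 * n ^ 2 := by rw [sq]; gcongr

/-! ### The Dehn function is at least quadratic -/

/-- The vertical shear of the square lattice with the given profile. -/
def latticeShear (p : ℤ → ℤ) : Equiv.Perm (ℤ × ℤ) where
  toFun z := (z.1, z.2 + p z.1)
  invFun z := (z.1, z.2 - p z.1)
  left_inv z := by simp
  right_inv z := by simp

/-- The horizontal translation of the square lattice. -/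
def latticeShift : Equiv.Perm (ℤ × ℤ) where
  toFun z := (z.1 + 1, z.2)
  invFun z := (z.1 - 1, z.2)
  left_inv z := by simp
  right_inv z := by simp

/-- A homomorphism to a nilpotent group that maps the relators to central elements. -/
def areaHom : FreeGroup GerstenGen →* Equiv.Perm (ℤ × ℤ) :=
  -- Conjugating the shift by a shear of profile `p` changes it by a shear whose profile is a
  -- difference of `p`. The profile `x * (x - 1)` has difference `2 * x`, so `s` and `t` realize
  -- their relations exactly; the factor `2` avoids division.
  FreeGroup.lift fun
    | .a => latticeShift
    | .b => latticeShear fun x => 2 * x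
    | .c => latticeShift * latticeShear fun x => 2 * x
    | .d => latticeShift * (latticeShear fun x => 2 * x)⁻¹
    | .s => latticeShear fun x => -(x * (x - 1))
    | .t => latticeShear fun x => x * (x - 1)

/-- The vertical translations of the square lattice. -/
abbrev vertShift (e : ℤ) : Equiv.Perm (ℤ × ℤ) := latticeShear fun _ => e

theorem vertShift_mul (e e' : ℤ) : vertShift e * vertShift e' = vertShift (e + e') := by
  ext z <;> simp [latticeShear]; ring

theorem vertShift_inv (e : ℤ) : (vertShift e)⁻¹ = vertShift (-e) := by
  rw [inv_eq_iff_mul_eq_one, vertShift_mul]; ext z <;> simp [latticeShear]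

theorem commute_vertShift (g : FreeGroup GerstenGen) (e : ℤ) :
    Commute (areaHom g) (vertShift e) := by
  have shear : ∀ p, Commute (latticeShear p) (vertShift e) := by
    intro p; ext z <;> simp [latticeShear]; ring
  have shift : Commute latticeShift (vertShift e) := by
    ext z <;> simp [latticeShear, latticeShift]
  induction g with
  | C1 => rw [map_one]; exact Commute.one_left _
  | of y =>
    rw [areaHom, FreeGroup.lift_apply_of]
    cases y
    · exact shift
    · exact shear _
    · exact shift.mul_left (shear _)
    · exact shift.mul_left (shear _).inv_left
    · exact shear _
    · exact shear _
  | inv_of y ih => rw [map_inv]; exact ih.inv_left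
  | mul g h hg hh => rw [map_mul]; exact hg.mul_left hh

theorem areaHom_relator {r : FreeGroup GerstenGen} (hr : r ∈ gerstenRels) :
    ∃ e : ℤ, e.natAbs ≤ 2 ∧ areaHom r = vertShift e := by
  simp only [gerstenRels, Set.mem_insert_iff, Set.mem_singleton_iff] at hr
  rcases hr with rfl | rfl | rfl | rfl | rfl <;>
    simp only [map_mul, map_inv, areaHom, gfree, FreeGroup.lift_apply_of]
  · exact ⟨0, by simp, by ext z <;> simp [latticeShear]⟩
  · exact ⟨2, by simp, by ext z <;> simp [latticeShear, latticeShift, Equiv.Perm.inv_def]; ring⟩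
  · exact ⟨0, by simp, by ext z <;> simp [latticeShear]⟩
  · exact ⟨0, by simp, by ext z <;> simp [latticeShear, latticeShift, Equiv.Perm.inv_def]; ring⟩
  · exact ⟨0, by simp, by ext z <;> simp [latticeShear, latticeShift, Equiv.Perm.inv_def]; ring⟩

/-- The relators go to vertical translations, which commute with the whole image. Conjugating
factors disappear, and the translation lengths add up to at most `2` per relator. -/
theorem areaHom_isRelatorProduct {k : ℕ} {v : FreeGroup GerstenGen}
    (h : IsRelatorProduct gerstenRels k v) :
    ∃ e : ℤ, e.natAbs ≤ 2 * k ∧ areaHom v = vertShift e := by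
  obtain ⟨L, rfl, rfl, hL⟩ := h
  induction L with
  | nil => exact ⟨0, by simp, by ext z <;> simp [latticeShear]⟩
  | cons y L ih =>
    obtain ⟨e, he, h1⟩ := ih fun z hz => hL z (List.mem_cons_of_mem _ hz)
    obtain ⟨g, r, hr, rfl⟩ := hL y List.mem_cons_self
    obtain ⟨e', he', h2⟩ : ∃ e : ℤ, e.natAbs ≤ 2 ∧ areaHom r = vertShift e := by
      rcases hr with hr | hr
      · exact areaHom_relator hr
      · obtain ⟨e, he, h⟩ := areaHom_relator hr
        refine ⟨-e, by simpa using he, ?_⟩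
        rw [← vertShift_inv, ← h, map_inv, inv_inv]
    refine ⟨e' + e, by simp only [List.length_cons]; omega, ?_⟩
    rw [List.prod_cons, map_mul, map_mul, map_mul, map_inv, h1, h2,
      (commute_vertShift g e').eq, mul_inv_cancel_right, vertShift_mul]

/-- The commutator of `a ^ n` and `b ^ n`. -/
def commWord (n : ℕ) : List (GerstenGen × Bool) :=
  List.replicate n (.a, true) ++ List.replicate n (.b, true) ++
    List.replicate n (.a, false) ++ List.replicate n (.b, false)

theorem mk_replicate (y : GerstenGen) (n : ℕ) :
    FreeGroup.mk (List.replicate n (y, true)) = gfree y ^ n ∧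
      FreeGroup.mk (List.replicate n (y, false)) = (gfree y ^ n)⁻¹ := by
  induction n with
  | zero => exact ⟨rfl, rfl⟩
  | succ n ih =>
    rw [List.replicate_succ, List.replicate_succ, mk_cons (y, true) (List.replicate n (y, true)),
      mk_cons (y, false) (List.replicate n (y, false)), ih.1, ih.2]
    refine ⟨?_, ?_⟩
    · rw [pow_succ']; rfl
    · rw [pow_succ, mul_inv_rev]; rfl

theorem mk_commWord (n : ℕ) : FreeGroup.mk (commWord n) =
    gfree .a ^ n * gfree .b ^ n * (gfree .a ^ n)⁻¹ * (gfree .b ^ n)⁻¹ := by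
  rw [commWord, ← FreeGroup.mul_mk, ← FreeGroup.mul_mk, ← FreeGroup.mul_mk]
  simp only [mk_replicate]

theorem areaHom_commWord (n : ℕ) :
    areaHom (FreeGroup.mk (commWord n)) = vertShift (-(2 * n * n)) := by
  have ha : ∀ (n : ℕ) z, (latticeShift ^ n) z = (z.1 + n, z.2) := by
    intro n
    induction n with
    | zero => simp
    | succ n ih => intro z; rw [pow_succ', Equiv.Perm.mul_apply, ih]; simp [latticeShift]; ring
  have hb : ∀ (n : ℕ) z,
      ((latticeShear fun x => 2 * x) ^ n) z = (z.1, z.2 + n * (2 * z.1)) := by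
    intro n
    induction n with
    | zero => simp
    | succ n ih => intro z; rw [pow_succ', Equiv.Perm.mul_apply, ih]; simp [latticeShear]; ring
  rw [mk_commWord, map_mul, map_mul, map_mul, map_inv, map_inv, map_pow, map_pow,
    mul_inv_eq_iff_eq_mul, mul_inv_eq_iff_eq_mul]
  have e1 : areaHom (gfree .a) = latticeShift := FreeGroup.lift_apply_of
  have e2 : areaHom (gfree .b) = latticeShear fun x => 2 * x := FreeGroup.lift_apply_of
  rw [e1, e2]
  ext z
  · simp only [Equiv.Perm.mul_apply, ha, hb]; simp [latticeShear]
  · simp only [Equiv.Perm.mul_apply, ha, hb]; simp [latticeShear]; ring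

theorem mk_commWord_eq_one (n : ℕ) :
    PresentedGroup.mk gerstenRels (FreeGroup.mk (commWord n)) = 1 := by
  rw [mk_commWord]
  simp only [map_mul, map_inv, map_pow]
  have := (commute_ab.pow_pow n n).eq
  change (PresentedGroup.mk gerstenRels (gfree .a)) ^ n *
    (PresentedGroup.mk gerstenRels (gfree .b)) ^ n = _ at this
  rw [this]
  exact mul_inv_eq_one.2 (mul_inv_cancel_right _ _)

/-- The commutator word translates vertically by `-2n²` and a relator by at most `2` in absolute
value, so at least `n²` relators are needed. -/
theorem sq_le_dehnFunction_gersten (n : ℕ) : n ^ 2 ≤ dehnFunction gerstenRels (4 * n) := by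
  -- The infimum that defines the area has to be attained: over an empty set it would be `0`.
  obtain ⟨j, -, hj⟩ := exists_isRelatorProduct (mk_commWord_eq_one n)
  have h1 : IsRelatorProduct gerstenRels (relArea gerstenRels (FreeGroup.mk (commWord n)))
      (FreeGroup.mk (commWord n)) := Nat.sInf_mem (s := {k | IsRelatorProduct _ k _}) ⟨j, hj⟩
  obtain ⟨e, he, h2⟩ := areaHom_isRelatorProduct h1
  rw [areaHom_commWord] at h2
  have h3 := congrArg Prod.snd (Equiv.congr_fun h2 (0, 0))
  simp only [latticeShear, Equiv.coe_fn_mk, zero_add] at h3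
  have h4 : n ^ 2 ≤ relArea gerstenRels (FreeGroup.mk (commWord n)) := by
    have h5 : e.natAbs = 2 * (n * n) := by
      rw [← h3, Int.natAbs_neg, mul_assoc, Int.natAbs_mul, Int.natAbs_mul]; simp
    rw [sq]; omega
  refine h4.trans (le_csSup (areaSet_finite _ _).bddAbove ?_)
  exact ⟨commWord n, by simp [commWord]; omega, mk_commWord_eq_one n, rfl⟩

theorem quadraticDehn_gersten : QuadraticDehn gerstenRels :=
  ⟨⟨36000, 1, 0, 0, 0, fun n => by simpa using dehnFunction_gersten_le n⟩,
    ⟨1, 4, 0, 0, 0, fun n => by simpa using sq_le_dehnFunction_gersten n⟩⟩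

theorem theorem6p9 :
    ¬ LoopShortening (presentedGens gerstenRels) ∧
    AlmostConvex (presentedGens gerstenRels) ∧
    QuadraticDehn gerstenRels ∧
    ¬ (∀ (α : Type) (_ : Finite α) (rels : Set (FreeGroup α)), rels.Finite →
        AlmostConvex (presentedGens rels) → QuadraticDehn rels →
        LoopShortening (presentedGens rels)) := by
  refine ⟨not_loopShortening_gersten, almostConvex_gersten, quadraticDehn_gersten, fun h => ?_⟩
  exact not_loopShortening_gersten (h GerstenGen inferInstance gerstenRels
    (by simp [gerstenRels]) almostConvex_gersten quadraticDehn_gersten)
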